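/- **Setting.** Let $X\subseteq\mathbb R^d$ be nonempty, closed and convex, let $f:X\to\mathbb R$ be convex, let $f'$ be an oracle returning a subgradient $f'(z)$ of $f$ at each $z\in X$, and write $\ell_f(x;z)=f(z)+\langle f'(z),x-z\rangle$, $f^*=\min_X f$, $X^*=\arg\min_X f\neq\emptyset$. * $f$ is *$\mu^*$-QG* if $\mu^*=\sup\{\mu: f(x)-f^*\ge \frac{\mu}{2}\,\mathrm{dist}^2(x,X^*)\ \forall x\in X\}$ (a real number); we assume $\mu^*>0$. * $f$ is *$(k,L)$-PWS*, $L>0$, if $X=\bigcup_{i=1}^kX_i$ with $f(x)-\ell_f(x;z)\le\frac L2\|x-z\|^2$ for all $i$ and all $x,z\in X_i$. * A finite set $\mathcal P\subseteq X\cap B(\bar y,\iota)$ containing $\bar y\in X$ is an *$(\iota,\nu)$-Normalized Wolfe certificate* at $\bar y$ ($\iota>0$, $\nu\ge0$) if $\frac1\iota\max_{x\in B(\bar y,\iota)\cap X}\big(\psi_{\mathcal P}(\bar y)-\psi_{\mathcal P}(x)\big)\le\nu$, where $\psi_{\mathcal P}(x)=\max_{z\in\mathcal P}\ell_f(x;z)$.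 **Algorithm.** Parameters: $\theta\in(\frac12,1)$, $\beta>0$, number of cuts $m$, $\bar y^0\in X$, guess $\hat\mu_1$. Put $\alpha_t=\frac4{t+3}$, $\omega_t=\frac{(t+2)(t+3)}2$. *Level run* with center $\bar y$ and level $\tilde l$. Start with $\hat x^0=x^{1,0}=\bar y$. Outer iteration $t\ge1$: for $i=1,\dots,m$ call the oracle at $\underline x^{t,i}=(1-\alpha_t)\hat x^{t-1}+\alpha_tx^{t,i-1}$ and let $x^{t,i}$ be the projection of $\bar y$ onto $X(t,i)=\{x\in X:\ \ell_f(x;\underline x^{t,j})\le\tilde l\ (1\le j\le i),\ \langle x-x^{t,0},x^{t,0}-\bar y\rangle\ge0\}$; if $X(t,i)=\emptyset$, set Flag and leave the loop. Then $\hat x^t$ is any point of least $f$-value among $\hat x^{t-1}$ and the points $(1-\alpha_t)\hat x^{t-1}+\alpha_tx^{t,j}$ computed, and $x^t=x^{t+1,0}$ is the last $x^{t,i}$ computed. $\mathcal P$ collects $\bar y$ and all points $\underline x^{t,i}$ at which the oracle was called. With $e_t=f(\hat x^t)-\tilde l-(1-\frac34\alpha_t)(f(\hat x^{t-1})-\tilde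 l)$, let $(r_t,l_t)$ minimize $L_t(r,l)=e_t\big/\big(\frac{\alpha_t^2}2\|x^{t,r}-x^{t,l}\|^2\big)$ over $0\le l<r\le m$ with $x^{t,r}\ne x^{t,l}$, let $L_t$ be the minimum, $D_t=\|x^{t,r_t}-x^{t,l_t}\|^2$, and $\bar L(t)=\sum_\tau\frac12\omega_\tau\alpha_\tau^2L_\tau D_\tau\big/\sum_\tau D_\tau$, the sums being over those $\tau\le t$ with $f(\hat x^\tau)-\tilde l>(1-\frac{\alpha_\tau}2)(f(\hat x^{\tau-1})-\tilde l)$ ($\bar L(t)=0$ if there are none). *AWG*$(\bar y,\Delta,\iota)$: level run with $\tilde l=f(\bar y)-(1+\beta)\Delta$. After each $t$: if Flag or $\|x^t-\bar y\|>\iota$, succeed and return $\mathcal P\cap B(\bar y,\iota)$; otherwise, if $\bar L(t)\|x^t-\bar y\|^2<\omega_t\beta\Delta-3(1+\beta)\Delta$ or $t\ge\sqrt{(2\iota^2\bar L(t)+6(1+\beta)\Delta)/(\beta\Delta)}$, fail. *AGR*$(\underline f,\Delta,\bar y,\mu)$: level run with $\tilde l=f(\bar y)-\theta\Delta$. After each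 $t$: if Flag or $\|x^t-\bar y\|^2\ge2\theta\Delta/\mu$, return "lower" and $\mathcal P\cap B(\bar y,\sqrt{2\theta\Delta/\mu})$; else if $f(\hat x^t)-\underline f\le\theta\Delta$, return "upper" and $\hat x^t$; else if $t\ge\Big\lceil\sqrt{\frac{6\theta}{2\theta-1}+\frac{4\bar L(t)\theta}{\mu(2\theta-1)}}\Big\rceil$, fail. *Main loop.* Start with $\tilde\Delta_1=2\|f'(\bar y^0)\|^2/\hat\mu_1$, $\underline f=f(\bar y^0)-\tilde\Delta_1$, $\Delta_0=+\infty$, $\mu_0=1$. Stage $s=1,2,\dots$: 1. Call AWG$\big(\bar y^{s-1},\tilde\Delta_s,\sqrt{2(1+\beta)\tilde\Delta_s/\hat\mu_s}\big)$. On failure put $\hat\mu_s\leftarrow\hat\mu_s/4$, then $\tilde\Delta_s\leftarrow\min\{\frac{9\mu_{s-1}}{4\hat\mu_s}\Delta_{s-1},\frac2{\hat\mu_s}\|f'(\bar y^{s-1})\|^2\}$, $\underline f\leftarrow f(\bar y^{s-1})-\tilde\Delta_s$, and repeat 1. On success put $\Delta_s=(1+\beta)\tilde\Delta_s$, $\mu_s=\hat\mu_s$,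 and let $\mathcal P_s$ be the returned set. 2. Call AGR$(\underline f,\tilde\Delta_s,\bar y^{s-1},\hat\mu_s)$. On failure put $\hat\mu_s\leftarrow\hat\mu_s/4$, then $\tilde\Delta_s\leftarrow\min\{4\Delta_s,\frac2{\hat\mu_s}\|f'(\bar y^{s-1})\|^2,\frac{9\mu_{s-1}}{4\hat\mu_s}\Delta_{s-1}\}$, $\underline f\leftarrow f(\bar y^{s-1})-\tilde\Delta_s$, and go to 1. On "lower" put $\tilde\Delta_s\leftarrow\theta\tilde\Delta_s$, $\underline f\leftarrow f(\bar y^{s-1})-\tilde\Delta_s$, $\Delta_s=\tilde\Delta_s$, $\mu_s=\hat\mu_s$, let $\mathcal P_s$ be the returned set, and repeat 2. On "upper" put $\bar y^s=\hat x^t$, $\tilde\Delta_{s+1}=f(\bar y^s)-\underline f$, $\hat\mu_{s+1}=\hat\mu_s$, and start stage $s+1$. **Theorem.** For all $\theta\in(\frac12,1)$ and $\beta>0$ there is a constant $C>0$, depending only on $\theta$ and $\beta$, such that the following holds. If $f$ is convex, $\mu^*$-QG and $(k,L)$-PWS, $m\ge k$, $\hat\mu_1\ge\mu^*$, $f'(\bar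 y^0)\neq0$ and $\varepsilon>0$, then, however ties are broken, the algorithm produces a set $\mathcal P_s$ that is an $(\varepsilon/\mu_s,\varepsilon)$-Normalized Wolfe certificate for $f$ at $\bar y^{s-1}$ (with the current $\mu_s$) after at most $$C\,m\,\max\Big\{1,\sqrt{\tfrac{L}{\mu^*}}\Big\}\Big(\log_4\frac{4\hat\mu_1}{\mu^*}+\max\Big\{0,\log\frac{\|f'(\bar y^0)\|^2}{\varepsilon^2}\Big\}\Big)$$ oracle calls in total; in particular every subroutine called until then terminates. -/

import Mathlib

namespace RApex

abbrev Vec (d : ℕ) := EuclideanSpace ℝ (Fin d)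

/-! ### The problem class -/

/-- The data of a problem `min_{x ∈ X} f x` with a first-order oracle `g` (written `f'` in prose).
Only the values of `f` and `g` on `X` are ever used. -/
structure Problem (d : ℕ) where
  X : Set (Vec d)
  f : Vec d → ℝ
  g : Vec d → Vec d

namespace Problem

variable {d : ℕ} (p : Problem d)

/-- The linearization `ℓ_f(x; z) = f z + ⟨f' z, x - z⟩`. -/
noncomputable def lin (x z : Vec d) : ℝ := p.f z + inner ℝ (p.g z) (x - z)

/-- The oracle returns a subgradient of `f : X → ℝ` at every point of `X`. -/
def IsSubgradientOracle : Prop := ∀ z ∈ p.X, ∀ x ∈ p.X, p.lin x z ≤ p.f x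

/-- `(k, L)`-piecewise smoothness. -/
def IsPWS (k : ℕ) (L : ℝ) : Prop :=
  0 < L ∧ ∃ piece : Fin k → Set (Vec d), (⋃ i, piece i) = p.X ∧
    ∀ i, ∀ x ∈ piece i, ∀ z ∈ piece i, p.f x - p.lin x z ≤ L * ‖x - z‖ ^ 2 / 2

/-- The set `X*` of minimizers of `f` over `X`. -/
def minimizers : Set (Vec d) := {x ∈ p.X | ∀ y ∈ p.X, p.f x ≤ p.f y}

/-- The optimal value `f*` (a minimum whenever `minimizers` is nonempty). -/
noncomputable def optVal : ℝ := sInf (p.f '' p.X)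

/-- `μ`-quadratic growth: `X*` is nonempty and `μ` is the largest modulus of quadratic growth. -/
def IsQG (μ : ℝ) : Prop :=
  p.minimizers.Nonempty ∧
    IsLUB {ν : ℝ | ∀ x ∈ p.X, ν * Metric.infDist x p.minimizers ^ 2 / 2 ≤ p.f x - p.optVal} μ

/-! ### Normalized Wolfe certificates -/

/-- The cutting-plane model `ψ_P(x) = max_{z ∈ P} ℓ_f(x; z)` of a finite nonempty set `P`. -/
noncomputable def model (P : Set (Vec d)) (x : Vec d) : ℝ := sSup ((fun z => p.lin x z) '' P)

/-- The normalized Wolfe gap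
`V_P(ι; y) = (1/ι) max {ψ_P(y) - ψ_P(x) : x ∈ B(y, ι) ∩ X}`. -/
noncomputable def wolfeGap (P : Set (Vec d)) (ι : ℝ) (y : Vec d) : ℝ :=
  1 / ι * sSup ((fun x => p.model P y - p.model P x) '' (Metric.closedBall y ι ∩ p.X))

/-- `P` is an `(ι, ν)`-normalized Wolfe certificate for `f` at the point `y`. -/
structure IsWCert (ι ν : ℝ) (y : Vec d) (P : Set (Vec d)) : Prop where
  radius_pos : 0 < ι
  slope_nonneg : 0 ≤ ν
  center_mem : y ∈ p.X
  finite : P.Finite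
  center_mem_points : y ∈ P
  points_mem : P ⊆ p.X
  points_mem_ball : P ⊆ Metric.closedBall y ι
  gap_le : p.wolfeGap P ι y ≤ ν

end Problem

/-! ### One outer iteration of the accelerated prox-level method -/

noncomputable def alpha (t : ℕ) : ℝ := 4 / ((t : ℝ) + 3)

noncomputable def omega (t : ℕ) : ℝ := ((t : ℝ) + 2) * ((t : ℝ) + 3) / 2

/-- `(1 - α) h + α x`. -/
noncomputable def mix {d : ℕ} (α : ℝ) (h x : Vec d) : Vec d := (1 - α) • h + α • x

open Classical in
/-- `argmin_{x ∈ S} ‖x - y‖²` (it exists and is unique if `S` is nonempty, closed and convex). -/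
noncomputable def nearest {d : ℕ} (y : Vec d) (S : Set (Vec d)) : Vec d :=
  if h : ∃ q ∈ S, ∀ x ∈ S, ‖q - y‖ ^ 2 ≤ ‖x - y‖ ^ 2 then h.choose else y

/-- The fixed data of one run of the prox-level method: problem, prox-center, level and number of
cuts. `pick t` is the rule by which outer iteration `t` chooses a best point of its finite
candidate set. -/
structure LevelTask (d : ℕ) where
  prob : Problem d
  center : Vec d
  level : ℝ
  cuts : ℕ
  pick : ℕ → Set (Vec d) → Vec d

namespace LevelTask

variable {d : ℕ} (T : LevelTask d)

/-- The pair `(x^{t,i}, X(t,i))` of an outer iteration with stepsize `α` that starts with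
`x̂^{t-1} = h` and `x^{t,0} = x₀`:
`X(t,i) = {x ∈ X : ℓ_f(x; x̲^{t,j}) ≤ level for 1 ≤ j ≤ i, ⟨x - x^{t,0}, x^{t,0} - center⟩ ≥ 0}`,
where `x̲^{t,j} = (1 - α) h + α x^{t,j-1}`, and `x^{t,i}` is the point of `X(t,i)` nearest to the
center. Once some `X(t,i)` is empty the later entries are never used. -/
noncomputable def bundle (α : ℝ) (h x₀ : Vec d) : ℕ → Vec d × Set (Vec d)
  | 0 => (x₀, {x ∈ T.prob.X | 0 ≤ inner ℝ (x - x₀) (x₀ - T.center)})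
  | i + 1 =>
    let S := (bundle α h x₀ i).2 ∩ {x | T.prob.lin x (mix α h (bundle α h x₀ i).1) ≤ T.level}
    (nearest T.center S, S)

/-- Some subproblem of the outer iteration is infeasible. -/
def infeasible (α : ℝ) (h x₀ : Vec d) : Prop :=
  ∃ i, 1 ≤ i ∧ i ≤ T.cuts ∧ (T.bundle α h x₀ i).2 = ∅

/-- The number of inner iterations that are started, hence the number of oracle points
`x̲^{t,1}, …, x̲^{t,steps}`: all `cuts` of them, or up to and including the first infeasible one. -/
noncomputable def steps (α : ℝ) (h x₀ : Vec d) : ℕ :=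
  sInf ({i | 1 ≤ i ∧ (T.bundle α h x₀ i).2 = ∅} ∪ {T.cuts})

open Classical in
/-- The number of inner iterations whose subproblem was feasible. -/
noncomputable def solved (α : ℝ) (h x₀ : Vec d) : ℕ :=
  if T.infeasible α h x₀ then T.steps α h x₀ - 1 else T.steps α h x₀

end LevelTask

/-- The ratio `L_t(r, l) = e / ((α² / 2) ‖x^{t,r} - x^{t,l}‖²)`, for `q = (r, l)`. -/
noncomputable def ratio {d : ℕ} (e α : ℝ) (x : ℕ → Vec d) (q : ℕ × ℕ) : ℝ :=
  e / (α ^ 2 / 2 * ‖x q.1 - x q.2‖ ^ 2)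

/-- The pairs `(r, l)`, `0 ≤ l < r ≤ m`, with `x^{t,r} ≠ x^{t,l}`. The ratio is only used when its
numerator is positive, so it counts as `+∞` for the remaining pairs. -/
def pairs {d : ℕ} (m : ℕ) (x : ℕ → Vec d) : Set (ℕ × ℕ) :=
  {q | q.2 < q.1 ∧ q.1 ≤ m ∧ x q.1 ≠ x q.2}

open Classical in
/-- A minimizer `(r_t, l_t)` of the ratio `L_t(r, l)`. -/
noncomputable def bestPair {d : ℕ} (m : ℕ) (e α : ℝ) (x : ℕ → Vec d) : ℕ × ℕ :=
  if h : ∃ q ∈ pairs m x, ∀ q' ∈ pairs m x, ratio e α x q ≤ ratio e α x q' then h.choose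
  else (0, 0)

/-- What is known after `t` outer iterations: `x̂^t`, `x^t`, the set of oracle points (with the
center), whether the last outer iteration met an infeasible subproblem, the number of oracle calls,
and the numerator and denominator of the averaged constant `L̄(t)`. -/
structure LevelState (d : ℕ) where
  best : Vec d
  x : Vec d
  points : Set (Vec d)
  flag : Prop
  calls : ℕ
  num : ℝ
  den : ℝ

/-- `L̄(t)`; it is `0` if no outer iteration has contributed to the sums. -/
noncomputable def LevelState.avgL {d : ℕ} (S : LevelState d) : ℝ := S.num / S.den

namespace LevelTask

variable {d : ℕ} (T : LevelTask d)

open Classical in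
/-- Outer iteration `t ≥ 1`. -/
noncomputable def oneStep (t : ℕ) (S : LevelState d) : LevelState d :=
  let α := alpha t
  let x : ℕ → Vec d := fun i => (T.bundle α S.best S.x i).1
  let n := T.steps α S.best S.x
  let n' := T.solved α S.best S.x
  let best' := T.pick t ({S.best} ∪ {z | ∃ j, 1 ≤ j ∧ j ≤ n' ∧ z = mix α S.best (x j)})
  let gapOld := T.prob.f S.best - T.level
  let gapNew := T.prob.f best' - T.level
  let e := gapNew - (1 - 3 / 4 * α) * gapOld
  let q := bestPair T.cuts e α x
  let Lt := ratio e α x q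
  let D := ‖x q.1 - x q.2‖ ^ 2
  let slow : Prop := gapNew > (1 - α / 2) * gapOld
  { best := best'
    x := x n'
    points := S.points ∪ ({T.center} ∪ {z | ∃ j, 1 ≤ j ∧ j ≤ n ∧ z = mix α S.best (x (j - 1))})
    flag := T.infeasible α S.best S.x
    calls := S.calls + n
    num := S.num + if slow then omega t * α ^ 2 * Lt * D / 2 else 0
    den := S.den + if slow then D else 0 }

/-- The state after `t` outer iterations. -/
noncomputable def state : ℕ → LevelState d
  | 0 => { best := T.center, x := T.center, points := {T.center}, flag := False, calls := 0,
           num := 0, den := 0 }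
  | t + 1 => T.oneStep (t + 1) (state t)

end LevelTask

open Classical in
/-- The first `t ≥ 1` at which a loop halts; `none` if it runs forever. -/
noncomputable def firstStop (halts : ℕ → Prop) : Option ℕ :=
  if h : ∃ t, 1 ≤ t ∧ halts t then some (Nat.find h) else none

/-! ### Accelerated certificate generation -/

/-- Answer of the certificate generation: `success = False` says that the guess was wrong. -/
structure AWGResult (d : ℕ) where
  success : Prop
  points : Set (Vec d)
  calls : ℕ

/-- Accelerated certificate generation `AWG(f, y, Δ, m, ιmax, β)`. -/
noncomputable def awg {d : ℕ} (p : Problem d) (pick : ℕ → Set (Vec d) → Vec d) (y : Vec d)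
    (Δ : ℝ) (m : ℕ) (ιmax β : ℝ) : Option (AWGResult d) :=
  let T : LevelTask d :=
    { prob := p, center := y, level := p.f y - (1 + β) * Δ, cuts := m, pick := pick }
  let accept : ℕ → Prop := fun t => (T.state t).flag ∨ ιmax < ‖(T.state t).x - y‖
  let reject : ℕ → Prop := fun t =>
    (T.state t).avgL * ‖(T.state t).x - y‖ ^ 2 < omega t * β * Δ - 3 * (1 + β) * Δ ∨
      √((2 * ιmax ^ 2 * (T.state t).avgL + 6 * (1 + β) * Δ) / (β * Δ)) ≤ (t : ℝ)
  (firstStop fun t => accept t ∨ reject t).map fun t =>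
    { success := accept t
      points := (T.state t).points ∩ Metric.closedBall y ιmax
      calls := (T.state t).calls }

/-! ### Accelerated gap reduction -/

/-- Answer of the gap reduction: `success = False` says that the guess was wrong; otherwise `upper`
tells whether the upper bound (`True`) or the lower bound (`False`) was improved. -/
structure AGRResult (d : ℕ) where
  success : Prop
  upper : Prop
  best : Vec d
  points : Set (Vec d)
  calls : ℕ

/-- Accelerated gap reduction `AGR(f, low, Δ, y, μ, θ, m)`. An infeasible subproblem counts as
an iterate at infinite distance from the center. -/
noncomputable def agr {d : ℕ} (p : Problem d) (pick : ℕ → Set (Vec d) → Vec d) (low Δ : ℝ)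
    (y : Vec d) (μ θ : ℝ) (m : ℕ) : Option (AGRResult d) :=
  let T : LevelTask d :=
    { prob := p, center := y, level := p.f y - θ * Δ, cuts := m, pick := pick }
  let far : ℕ → Prop := fun t =>
    (T.state t).flag ∨ 2 * θ * Δ / μ ≤ ‖(T.state t).x - y‖ ^ 2
  let descent : ℕ → Prop := fun t => p.f (T.state t).best - low ≤ θ * Δ
  let late : ℕ → Prop := fun t =>
    ⌈√(6 * θ / (2 * θ - 1) + 4 * (T.state t).avgL * θ / (μ * (2 * θ - 1)))⌉₊ ≤ t
  (firstStop fun t => far t ∨ descent t ∨ late t).map fun t =>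
    { success := far t ∨ descent t
      upper := ¬ far t
      best := (T.state t).best
      points := (T.state t).points ∩ Metric.closedBall y √(2 * θ * Δ / μ)
      calls := (T.state t).calls }

/-! ### The restarted method for unknown `μ*` -/

/-- The next subroutine to be called. -/
inductive Phase
  | generate
  | reduce

/-- State of the restarted method during stage `s`, between two subroutine calls: the center
`y = ȳ^{s-1}`, the guess `muHat = μ̂_s`, the gap estimate `gap = Δ̃_s`, the lower estimate `low` of
`f*`, the pair `prev = (μ_{s-1}, Δ_{s-1})` (`none` in the first stage, where `Δ_0 = +∞`), the
values `mu = μ_s`, `delta = Δ_s`, `points = P_s`, and the number of oracle calls made so far. The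
values `mu`, `delta`, `points` belong to stage `s` exactly when `phase = reduce`. -/
structure RState (d : ℕ) where
  phase : Phase
  y : Vec d
  muHat : ℝ
  gap : ℝ
  low : ℝ
  prev : Option (ℝ × ℝ)
  mu : ℝ
  delta : ℝ
  points : Set (Vec d)
  calls : ℕ

/-- `min {9 μ_{s-1} Δ_{s-1} / (4 μ̂), b}`, which is `b` in the first stage. -/
noncomputable def transferMin (prev : Option (ℝ × ℝ)) (muHat b : ℝ) : ℝ :=
  match prev with
  | none => b
  | some (μ, Δ) => min (9 * μ / (4 * muHat) * Δ) b

/-- Initial state; it costs one oracle call, at `y₀`. -/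
noncomputable def initial {d : ℕ} (p : Problem d) (y₀ : Vec d) (muHat₁ : ℝ) : RState d :=
  { phase := .generate
    y := y₀
    muHat := muHat₁
    gap := 2 * ‖p.g y₀‖ ^ 2 / muHat₁
    low := p.f y₀ - 2 * ‖p.g y₀‖ ^ 2 / muHat₁
    prev := none
    mu := 1
    delta := 0
    points := ∅
    calls := 1 }

open Classical in
/-- One subroutine call with the updates that follow it. -/
noncomputable def next {d : ℕ} (p : Problem d) (m : ℕ) (θ β : ℝ)
    (pick : ℕ → Set (Vec d) → Vec d) (S : RState d) : Option (RState d) :=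
  match S.phase with
  | .generate =>
    (awg p pick S.y S.gap m √(2 * (1 + β) * S.gap / S.muHat) β).map fun r =>
      if r.success then
        { S with
          phase := .reduce
          delta := (1 + β) * S.gap
          mu := S.muHat
          points := r.points
          calls := S.calls + r.calls }
      else
        let μ' := S.muHat / 4
        let gap' := transferMin S.prev μ' (2 / μ' * ‖p.g S.y‖ ^ 2)
        { S with
          muHat := μ'
          gap := gap'
          low := p.f S.y - gap'
          calls := S.calls + r.calls + 1 }
  | .reduce =>
    (agr p pick S.low S.gap S.y S.muHat θ m).map fun r =>
      if r.success then
        if r.upper then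
          { S with
            phase := .generate
            y := r.best
            gap := p.f r.best - S.low
            prev := some (S.mu, S.delta)
            calls := S.calls + r.calls }
        else
          { S with
            gap := θ * S.gap
            low := p.f S.y - θ * S.gap
            delta := θ * S.gap
            mu := S.muHat
            points := r.points
            calls := S.calls + r.calls }
      else
        let μ' := S.muHat / 4
        let gap' := min (4 * S.delta) (transferMin S.prev μ' (2 / μ' * ‖p.g S.y‖ ^ 2))
        { S with
          phase := .generate
          muHat := μ'
          gap := gap'
          low := p.f S.y - gap'
          calls := S.calls + r.calls + 1 }

/-- The state after `n` subroutine calls (`none` if one of them never returns). `pick n t` is the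
selection rule in outer iteration `t` of the `n`-th call. -/
noncomputable def run {d : ℕ} (p : Problem d) (m : ℕ) (θ β : ℝ)
    (pick : ℕ → ℕ → Set (Vec d) → Vec d) (y₀ : Vec d) (muHat₁ : ℝ) : ℕ → Option (RState d)
  | 0 => some (initial p y₀ muHat₁)
  | n + 1 => (run p m θ β pick y₀ muHat₁ n).bind (next p m θ β (pick n))

/-- Every rule `pick n t` returns a point of least `f`-value of any finite nonempty set; how ties
are broken is left open. -/
def IsBestPick {d : ℕ} (f : Vec d → ℝ) (pick : ℕ → ℕ → Set (Vec d) → Vec d) : Prop :=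
  ∀ n t, ∀ S : Set (Vec d), S.Finite → S.Nonempty →
    pick n t S ∈ S ∧ ∀ z ∈ S, f (pick n t S) ≤ f z

end RApex

namespace RApex

/-! The central object is a set of cuts that keeps the model above `f y - δ` on a ball of radius `r`
around `y` (`Problem.BallCert`). Cuts are affine and lie below `f` at `y`, so outside the ball the
drop is at most linear with slope `δ / r`. Such a set is therefore a Wolfe certificate on larger
balls. If `r ^ 2 = 2 * δ / a`, comparing linear drop with quadratic growth bounds the optimality gap
of `y` by `max 1 (a / μ) * δ`.

In a level run, two of the `m + 1` mixed points lie in one smooth piece, so an outer iteration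
progresses like an accelerated step on a smooth function, with an error proportional to a squared
displacement (`exists_pair_gap_le`). Pythagoras for nested projections sums these displacements to
at most `‖x - center‖ ^ 2`. Hence either the run leaves the ball or becomes infeasible, which yields
a `BallCert`, or the level gap decays like `1 / omega t`. With `avgL ≤ 4 * L`, a multiple of `max 1
√(L / μ)` iterations suffices. A failed `awg` exhibits a point below `f y - Δ`; `agr`, called with
the lower estimate `f y - Δ`, never fails.

Across restarts, the gap estimate is correct whenever the guess is at most `μ`, so failures occur
only above `μ` and the guess stays above `μ / 4`. The product of guess and gap estimate is dominated
by `potential`, which a failure multiplies by `9 * (1 + β) / (4 * θ)` and a gap reduction by `θ`. A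
certificate is reached once `2 * mu * delta ≤ ε ^ 2`, so the number of subroutine calls is
logarithmic. -/

theorem mix_mem {d : ℕ} {X : Set (Vec d)} (hX : Convex ℝ X) {α : ℝ} (h0 : 0 ≤ α) (h1 : α ≤ 1)
    {h x : Vec d} (hh : h ∈ X) (hx : x ∈ X) : mix α h x ∈ X :=
  hX hh hx (by linarith) h0 (by ring)

theorem norm_mix_sub_le {d : ℕ} {α : ℝ} (h0 : 0 ≤ α) (h1 : α ≤ 1) {h x c : Vec d} {R : ℝ}
    (hh : ‖h - c‖ ≤ R) (hx : ‖x - c‖ ≤ R) : ‖mix α h x - c‖ ≤ R := by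
  have := mix_mem (convex_closedBall c R) h0 h1 (h := h) (x := x)
    (by simpa [dist_eq_norm] using hh) (by simpa [dist_eq_norm] using hx)
  simpa [dist_eq_norm] using this

theorem mix_right_sub {d : ℕ} (s : ℝ) (x c : Vec d) : mix s x c - c = (1 - s) • (x - c) := by
  simp only [mix]; module

theorem norm_mix_right_sub {d : ℕ} {s : ℝ} (hs : s ≤ 1) (x c : Vec d) :
    ‖mix s x c - c‖ = (1 - s) * ‖x - c‖ := by
  rw [mix_right_sub, norm_smul, Real.norm_of_nonneg (by linarith)]

theorem mix_sub_mix {d : ℕ} (α : ℝ) (h x z : Vec d) : mix α h x - mix α h z = α • (x - z) := by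
  simp only [mix]; module

theorem convex_mix_le {d : ℕ} {X : Set (Vec d)} {f : Vec d → ℝ} (hf : ConvexOn ℝ X f) {α : ℝ}
    (h0 : 0 ≤ α) (h1 : α ≤ 1) {h x : Vec d} (hh : h ∈ X) (hx : x ∈ X) :
    f (mix α h x) ≤ (1 - α) * f h + α * f x := by
  simpa [mix] using hf.2 hh hx (by linarith : (0 : ℝ) ≤ 1 - α) h0 (by ring)

/-! ### Quadratic growth and certificates on a ball. -/

namespace Problem

variable {d : ℕ} {p : Problem d}

theorem lin_mix (α : ℝ) (h x z : Vec d) :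
    p.lin (mix α h x) z = (1 - α) * p.lin h z + α * p.lin x z := by
  have : mix α h x - z = (1 - α) • (h - z) + α • (x - z) := by simp only [mix]; module
  simp only [lin, this, inner_add_right, inner_smul_right]; ring

theorem continuous_lin (z : Vec d) : Continuous fun x => p.lin x z := by
  unfold lin; fun_prop

theorem convex_lin_le (z : Vec d) (c : ℝ) : Convex ℝ {x | p.lin x z ≤ c} := by
  intro x hx y hy a b ha hb hab
  have h := lin_mix (p := p) b x y z
  have ha' : 1 - b = a := by linarith
  simp only [mix, ha'] at h
  simp only [Set.mem_ofPred_eq] at hx hy ⊢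
  rw [h]
  calc a * p.lin x z + b * p.lin y z ≤ a * c + b * c := by gcongr
    _ = c := by rw [← add_mul, hab, one_mul]

theorem optVal_eq {x : Vec d} (hx : x ∈ p.minimizers) : p.optVal = p.f x := by
  refine IsLeast.csInf_eq ⟨⟨x, hx.1, rfl⟩, ?_⟩
  rintro _ ⟨y, hy, rfl⟩
  exact hx.2 y hy

theorem IsQG.optVal_le {μ : ℝ} (h : p.IsQG μ) {x : Vec d} (hx : x ∈ p.X) :
    p.optVal ≤ p.f x := by
  obtain ⟨z, hz⟩ := h.1
  rw [optVal_eq hz]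
  exact hz.2 x hx

/-- The supremum is itself an admissible modulus: at each `x` off the solution set, the growth
quotient at `x` bounds every admissible modulus. -/
theorem IsQG.growth {μ : ℝ} (h : p.IsQG μ) {x : Vec d} (hx : x ∈ p.X) :
    μ * Metric.infDist x p.minimizers ^ 2 / 2 ≤ p.f x - p.optVal := by
  rcases (sq_nonneg (Metric.infDist x p.minimizers)).eq_or_lt with h0 | h0
  · rw [← h0]
    linarith [h.optVal_le hx]
  · have : μ ≤ 2 * (p.f x - p.optVal) / Metric.infDist x p.minimizers ^ 2 := by
      refine h.2.2 fun ν hν => ?_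
      rw [le_div_iff₀ h0]
      linarith [hν x hx]
    rw [le_div_iff₀ h0] at this
    linarith

theorem IsQG.growth_of_le {μ a : ℝ} (h : p.IsQG μ) (hμ : 0 ≤ μ) {x : Vec d} (hx : x ∈ p.X)
    (ha : 0 ≤ a) (hd : ∀ z ∈ p.minimizers, a ≤ ‖z - x‖) :
    μ * a ^ 2 / 2 ≤ p.f x - p.optVal := by
  have h1 : a ≤ Metric.infDist x p.minimizers := by
    refine (Metric.le_infDist h.1).2 fun z hz => ?_
    rw [dist_comm, dist_eq_norm]
    exact hd z hz
  refine le_trans ?_ (h.growth hx)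
  gcongr

/-- The subgradient inequality forces every minimizer to be at distance at least gap divided by
`‖p.g x‖`; quadratic growth at that distance gives the bound. -/
theorem IsQG.gap_le_grad {μ : ℝ} (h : p.IsQG μ) (hμ : 0 < μ) (ho : p.IsSubgradientOracle)
    {x : Vec d} (hx : x ∈ p.X) : p.f x - p.optVal ≤ 2 * ‖p.g x‖ ^ 2 / μ := by
  have key : ∀ z ∈ p.minimizers, p.f x - p.optVal ≤ ‖p.g x‖ * ‖z - x‖ := by
    intro z hz
    have h1 := ho x hx z hz.1
    have h2 := abs_real_inner_le_norm (p.g x) (z - x)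
    have h3 := neg_abs_le (inner ℝ (p.g x) (z - x))
    rw [optVal_eq hz]
    unfold lin at h1
    linarith
  have hG := sub_nonneg.2 (h.optVal_le hx)
  rcases (norm_nonneg (p.g x)).eq_or_lt with h0 | h0
  · obtain ⟨z, hz⟩ := h.1
    have := key z hz
    rw [← h0] at this ⊢
    simpa using this
  · have h1 := h.growth_of_le hμ.le hx (a := (p.f x - p.optVal) / ‖p.g x‖) (by positivity)
      fun z hz => by
        rw [div_le_iff₀ h0, mul_comm]; exact key z hz
    generalize p.f x - p.optVal = G at *
    rcases hG.eq_or_lt with h2 | h2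
    · rw [← h2]; positivity
    · rw [le_div_iff₀ hμ]
      rw [div_pow, ← mul_div_assoc, div_div, div_le_iff₀ (by positivity)] at h1
      have : G * (G * μ) ≤ G * (2 * ‖p.g x‖ ^ 2) := by linarith
      exact le_of_mul_le_mul_left this h2

/-- A finite set `P` of points in the ball of radius `r` around `y` whose cutting planes show that
`f` drops by at most `δ` on this ball. -/
structure BallCert (p : Problem d) (y : Vec d) (r δ : ℝ) (P : Set (Vec d)) : Prop where
  finite : P.Finite
  center_mem : y ∈ P
  subset : P ⊆ p.X
  subset_ball : P ⊆ Metric.closedBall y r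
  drop_le : ∀ x ∈ p.X, ‖x - y‖ ≤ r → ∃ z ∈ P, p.f y - δ ≤ p.lin x z

/-- Scale `x` back to the sphere of radius `r`, use the cut that is good there, and extend it
affinely; at `y` that cut is at most `f y`. -/
theorem BallCert.drop_le_mul {y : Vec d} {r δ : ℝ} {P : Set (Vec d)} (h : p.BallCert y r δ P)
    (hX : Convex ℝ p.X) (ho : p.IsSubgradientOracle) (hr : 0 < r) {x : Vec d} (hx : x ∈ p.X)
    (hxr : r ≤ ‖x - y‖) : ∃ z ∈ P, p.f y - p.lin x z ≤ δ / r * ‖x - y‖ := by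
  have hy := h.subset h.center_mem
  have hpos : 0 < ‖x - y‖ := hr.trans_le hxr
  set s := r / ‖x - y‖ with hs
  have hs0 : 0 < s := by positivity
  have hs1 : s ≤ 1 := (div_le_one hpos).2 hxr
  have hn : ‖mix s y x - y‖ ≤ r := by
    have : mix s y x - y = s • (x - y) := by simp only [mix]; module
    rw [this, norm_smul, Real.norm_of_nonneg hs0.le, hs, div_mul_cancel₀ _ hpos.ne']
  obtain ⟨z, hz, hle⟩ := h.drop_le _ (mix_mem hX hs0.le hs1 hy hx) hn
  refine ⟨z, hz, ?_⟩
  rw [lin_mix] at hle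
  have h1 := ho z (h.subset hz) y hy
  have h2 : s * (p.f y - p.lin x z) ≤ δ := by
    nlinarith [mul_le_mul_of_nonneg_left h1 (by linarith : (0 : ℝ) ≤ 1 - s)]
  have h3 : δ / r * ‖x - y‖ = δ / s := by rw [hs]; field_simp
  rw [h3, le_div_iff₀ hs0]
  linarith

theorem BallCert.isWCert {y : Vec d} {r δ R : ℝ} {P : Set (Vec d)} (h : p.BallCert y r δ P)
    (hX : Convex ℝ p.X) (ho : p.IsSubgradientOracle) (hr : 0 < r) (hδ : 0 ≤ δ) (hR : r ≤ R)
    {ν : ℝ} (hν : δ / r ≤ ν) : p.IsWCert R ν y P := by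
  have hy := h.subset h.center_mem
  have hR0 : 0 < R := hr.trans_le hR
  refine ⟨hR0, le_trans (by positivity) hν, hy, h.finite, h.center_mem, h.subset,
    h.subset_ball.trans (Metric.closedBall_subset_closedBall hR), ?_⟩
  have hdr : 0 ≤ δ / r := by positivity
  have hsup : sSup ((fun x => p.model P y - p.model P x) '' (Metric.closedBall y R ∩ p.X)) ≤
      ν * R := by
    refine csSup_le (Set.Nonempty.image _ ⟨y, Metric.mem_closedBall_self hR0.le, hy⟩) ?_
    rintro _ ⟨x, ⟨hxR, hx⟩, rfl⟩
    have hy1 : p.model P y ≤ p.f y := by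
      refine csSup_le (Set.Nonempty.image _ ⟨y, h.center_mem⟩) ?_
      rintro _ ⟨z, hz, rfl⟩
      exact ho z (h.subset hz) y hy
    have hlow : ∀ z ∈ P, p.lin x z ≤ p.model P x := fun z hz =>
      le_csSup (h.finite.image _).bddAbove ⟨z, hz, rfl⟩
    have hxR' : ‖x - y‖ ≤ R := by simpa [dist_eq_norm] using hxR
    have hνR : δ / r * R ≤ ν * R := by gcongr
    rcases le_total ‖x - y‖ r with hc | hc
    · obtain ⟨z, hz, hle⟩ := h.drop_le x hx hc
      have h1 : δ ≤ δ / r * R := by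
        calc δ = δ / r * r := by field_simp
          _ ≤ _ := by gcongr
      dsimp only
      linarith [hlow z hz]
    · obtain ⟨z, hz, hle⟩ := h.drop_le_mul hX ho hr hx hc
      have h1 : δ / r * ‖x - y‖ ≤ δ / r * R := by gcongr
      dsimp only
      linarith [hlow z hz]
  unfold wolfeGap
  calc 1 / R * _ ≤ 1 / R * (ν * R) := by gcongr
    _ = ν := by field_simp

/-- If the gap `G` exceeds `δ`, every minimizer lies outside the ball, and linear drop puts it at
distance at least `G * r / δ`. Quadratic growth then gives `G ≥ μ * G ^ 2 / (a * δ)`. For `a ≤ μ`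
the certificate proves the gap estimate `δ`. -/
theorem BallCert.gap_le {y : Vec d} {r δ a μ : ℝ} {P : Set (Vec d)} (h : p.BallCert y r δ P)
    (hX : Convex ℝ p.X) (ho : p.IsSubgradientOracle) (hq : p.IsQG μ) (hμ : 0 < μ) (hr : 0 < r)
    (hδ : 0 < δ) (ha : 0 < a) (hra : r ^ 2 = 2 * δ / a) :
    p.f y - p.optVal ≤ max 1 (a / μ) * δ := by
  have hy := h.subset h.center_mem
  by_contra! hcon
  have hG : δ < p.f y - p.optVal :=
    lt_of_le_of_lt (by nlinarith [le_max_left 1 (a / μ)]) hcon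
  have hdist : ∀ z ∈ p.minimizers, (p.f y - p.optVal) * r / δ ≤ ‖z - y‖ := by
    intro z hz
    rw [optVal_eq hz] at hG ⊢
    rcases le_total ‖z - y‖ r with hc | hc
    · obtain ⟨w, hw, hle⟩ := h.drop_le z hz.1 hc
      linarith [ho w (h.subset hw) z hz.1]
    · obtain ⟨w, hw, hle⟩ := h.drop_le_mul hX ho hr hz.1 hc
      have h1 := ho w (h.subset hw) z hz.1
      rw [div_le_iff₀ hδ]
      have h2 : p.f y - p.f z ≤ δ / r * ‖z - y‖ := by linarith
      calc (p.f y - p.f z) * r ≤ δ / r * ‖z - y‖ * r := by gcongr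
        _ = _ := by field_simp
  have h1 := hq.growth_of_le hμ.le hy (by
    have : 0 < p.f y - p.optVal := hδ.trans hG
    positivity) hdist
  generalize p.f y - p.optVal = G at *
  have hG0 : 0 < G := hδ.trans hG
  have h2 : G ≤ a / μ * δ := by
    rw [div_pow, mul_pow, hra] at h1
    have h3 : μ * (G ^ 2 * (2 * δ / a) / δ ^ 2) / 2 = G * (G * μ / (a * δ)) := by field_simp
    rw [h3] at h1
    have h4 : G * μ / (a * δ) ≤ 1 := by
      by_contra! hc
      nlinarith
    rw [div_le_one (by positivity)] at h4
    rw [div_mul_eq_mul_div, le_div_iff₀ hμ]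
    exact h4
  exact absurd (h2.trans (by gcongr; exact le_max_right _ _)) (not_le.2 hcon)

end Problem
-- Projections, step sizes and weights.
theorem nearest_spec {d : ℕ} (y : Vec d) {S : Set (Vec d)} (hc : IsClosed S) (hS : Convex ℝ S)
    (hne : S.Nonempty) :
    nearest y S ∈ S ∧ ∀ x ∈ S, 0 ≤ inner ℝ (x - nearest y S) (nearest y S - y) := by
  have hex : ∃ q ∈ S, ∀ x ∈ S, ‖q - y‖ ^ 2 ≤ ‖x - y‖ ^ 2 := by
    obtain ⟨q, hq, hd⟩ := hc.exists_infDist_eq_dist hne y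
    refine ⟨q, hq, fun x hx => ?_⟩
    rw [← dist_eq_norm, ← dist_eq_norm, dist_comm q, dist_comm x, ← hd]
    have := Metric.infDist_le_dist_of_mem (x := y) hx
    have := Metric.infDist_nonneg (x := y) (s := S)
    gcongr
  have hval : nearest y S = hex.choose := by unfold nearest; rw [dif_pos hex]
  obtain ⟨hq, hmin⟩ := hex.choose_spec
  rw [← hval] at hq hmin
  refine ⟨hq, fun x hx => ?_⟩
  have : Nonempty S := hne.to_subtype
  have heq : ‖y - nearest y S‖ = ⨅ w : S, ‖y - w‖ := by
    refine le_antisymm (le_ciInf fun w => ?_) (ciInf_le ⟨0, ?_⟩ (⟨_, hq⟩ : S))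
    · rw [norm_sub_rev y, norm_sub_rev y]
      exact le_of_sq_le_sq (hmin w w.2) (norm_nonneg _)
    · rintro _ ⟨w, rfl⟩
      exact norm_nonneg _
  have h1 := (norm_eq_iInf_iff_real_inner_le_zero hS hq).1 heq x hx
  rw [real_inner_comm, ← neg_sub y (nearest y S), inner_neg_left]
  linarith

theorem norm_sq_add_le {d : ℕ} {x q c : Vec d} (h : 0 ≤ inner ℝ (x - q) (q - c)) :
    ‖q - c‖ ^ 2 + ‖x - q‖ ^ 2 ≤ ‖x - c‖ ^ 2 := by
  have : x - c = (x - q) + (q - c) := by abel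
  rw [this, norm_add_sq_real]
  linarith

theorem alpha_nonneg (t : ℕ) : 0 ≤ alpha t := by unfold alpha; positivity

theorem alpha_pos (t : ℕ) : 0 < alpha t := by unfold alpha; positivity

theorem alpha_succ_le_one (t : ℕ) : alpha (t + 1) ≤ 1 := by
  unfold alpha
  rw [div_le_one (by positivity)]
  push_cast
  linarith [Nat.cast_nonneg (α := ℝ) t]

theorem omega_pos (t : ℕ) : 0 < omega t := by unfold omega; positivity

/-- The weights are built for telescoping: an iteration contracting the level gap by `1 - alpha / 2`
does not increase the weighted gap. -/
theorem omega_succ_mul (t : ℕ) : omega (t + 1) * (1 - alpha (t + 1) / 2) = omega t := by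
  unfold omega alpha
  push_cast
  field_simp
  ring

theorem omega_mul_alpha_sq_le (t : ℕ) : omega t * alpha t ^ 2 ≤ 8 := by
  unfold omega alpha
  rw [div_pow, div_mul_div_comm, div_le_iff₀ (by positivity)]
  nlinarith [Nat.cast_nonneg (α := ℝ) t]

theorem sq_div_two_lt_omega (t : ℕ) : (t : ℝ) ^ 2 / 2 < omega t := by
  unfold omega
  nlinarith [Nat.cast_nonneg (α := ℝ) t]

theorem bestPair_spec {d : ℕ} {m : ℕ} {e α : ℝ} {x : ℕ → Vec d} (h : (pairs m x).Nonempty) :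
    bestPair m e α x ∈ pairs m x ∧
      ∀ q ∈ pairs m x, ratio e α x (bestPair m e α x) ≤ ratio e α x q := by
  have hfin : (pairs m x).Finite := by
    refine ((Set.finite_Iic m).prod (Set.finite_Iic m)).subset fun q hq => ?_
    exact ⟨hq.2.1, hq.1.le.trans hq.2.1⟩
  have hex : ∃ q ∈ pairs m x, ∀ q' ∈ pairs m x, ratio e α x q ≤ ratio e α x q' :=
    Set.exists_min_image _ _ hfin h
  have hval : bestPair m e α x = hex.choose := by unfold bestPair; rw [dif_pos hex]
  rw [hval]
  exact hex.choose_spec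

/-! ### Inner iterations of a level run: nested localizers and their projections. -/

namespace LevelTask

variable {d : ℕ} {T : LevelTask d} {k : ℕ} {L : ℝ}

/-- The standing assumptions on a run of the prox-level method. -/
structure Valid (T : LevelTask d) (k : ℕ) (L : ℝ) : Prop where
  closed : IsClosed T.prob.X
  convexOn : ConvexOn ℝ T.prob.X T.prob.f
  oracle : T.prob.IsSubgradientOracle
  pws : T.prob.IsPWS k L
  le_cuts : k ≤ T.cuts
  center_mem : T.center ∈ T.prob.X
  level_lt : T.level < T.prob.f T.center
  pick_spec : ∀ t, ∀ S : Set (Vec d), S.Finite → S.Nonempty →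
    T.pick t S ∈ S ∧ ∀ z ∈ S, T.prob.f (T.pick t S) ≤ T.prob.f z

section bundle

variable {α : ℝ} {h x₀ : Vec d}

theorem bundle_regular (hT : T.Valid k L) (i : ℕ) : IsClosed (T.bundle α h x₀ i).2 ∧
    Convex ℝ (T.bundle α h x₀ i).2 ∧ (T.bundle α h x₀ i).2 ⊆ T.prob.X := by
  induction i with
  | zero =>
    have hset : (T.bundle α h x₀ 0).2 =
        T.prob.X ∩ {x | 0 ≤ inner ℝ (x - x₀) (x₀ - T.center)} := rfl
    rw [hset]
    refine ⟨hT.closed.inter (isClosed_le (by fun_prop) (by fun_prop)),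
      hT.convexOn.1.inter ?_, Set.inter_subset_left⟩
    intro x hx y hy a b ha hb hab
    simp only [Set.mem_ofPred_eq] at hx hy ⊢
    have : a • x + b • y - x₀ = a • (x - x₀) + b • (y - x₀) := by
      have hb' : b = 1 - a := by linarith
      subst hb'; module
    rw [this, inner_add_left, real_inner_smul_left, real_inner_smul_left]
    positivity
  | succ i ih =>
    refine ⟨ih.1.inter (isClosed_le (Problem.continuous_lin _) continuous_const),
      ih.2.1.inter (Problem.convex_lin_le _ _), Set.inter_subset_left.trans ih.2.2⟩

theorem bundle_antitone : Antitone fun i => (T.bundle α h x₀ i).2 :=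
  antitone_nat_of_succ_le fun _ => Set.inter_subset_left

/-- For `i = 0` nothing is projected: the half-space in the initial localizer is exactly the
optimality condition making `x₀` the projection of the center onto it. -/
theorem bundle_spec (hT : T.Valid k L) (hx₀ : x₀ ∈ T.prob.X) {i : ℕ}
    (hne : (T.bundle α h x₀ i).2.Nonempty) :
    (T.bundle α h x₀ i).1 ∈ (T.bundle α h x₀ i).2 ∧ ∀ x ∈ (T.bundle α h x₀ i).2,
      0 ≤ inner ℝ (x - (T.bundle α h x₀ i).1) ((T.bundle α h x₀ i).1 - T.center) := by
  cases i with
  | zero => exact ⟨⟨hx₀, by simp [bundle]⟩, fun x hx => hx.2⟩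
  | succ i =>
    obtain ⟨h1, h2, -⟩ := bundle_regular (α := α) (h := h) (x₀ := x₀) hT (i + 1)
    exact nearest_spec T.center h1 h2 hne

/-- Pythagoras for projections onto nested sets: the later iterate belongs to the earlier localizer.
-/
theorem bundle_norm_sq_add_le (hT : T.Valid k L) (hx₀ : x₀ ∈ T.prob.X) {i j : ℕ} (hij : i ≤ j)
    (hne : (T.bundle α h x₀ j).2.Nonempty) :
    ‖(T.bundle α h x₀ i).1 - T.center‖ ^ 2 +
      ‖(T.bundle α h x₀ j).1 - (T.bundle α h x₀ i).1‖ ^ 2 ≤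
      ‖(T.bundle α h x₀ j).1 - T.center‖ ^ 2 := by
  have hsub := bundle_antitone (T := T) (α := α) (h := h) (x₀ := x₀) hij
  exact norm_sq_add_le ((bundle_spec hT hx₀ (hne.mono hsub)).2 _
    (hsub (bundle_spec hT hx₀ hne).1))

theorem bundle_norm_le (hT : T.Valid k L) (hx₀ : x₀ ∈ T.prob.X) {i j : ℕ} (hij : i ≤ j)
    (hne : (T.bundle α h x₀ j).2.Nonempty) :
    ‖(T.bundle α h x₀ i).1 - T.center‖ ≤ ‖(T.bundle α h x₀ j).1 - T.center‖ := by
  refine le_of_sq_le_sq ?_ (norm_nonneg _)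
  linarith [bundle_norm_sq_add_le (α := α) (h := h) hT hx₀ hij hne,
    sq_nonneg ‖(T.bundle α h x₀ j).1 - (T.bundle α h x₀ i).1‖]

theorem mem_bundle {x : Vec d} (hx : x ∈ T.prob.X) (h0 : 0 ≤ inner ℝ (x - x₀) (x₀ - T.center))
    {j : ℕ} (hcut : ∀ i < j, T.prob.lin x (mix α h (T.bundle α h x₀ i).1) ≤ T.level) :
    x ∈ (T.bundle α h x₀ j).2 := by
  induction j with
  | zero => exact ⟨hx, h0⟩
  | succ j ih => exact ⟨ih fun i hi => hcut i (by omega), hcut j (by omega)⟩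

theorem bundle_zero_nonempty (hx₀ : x₀ ∈ T.prob.X) : (T.bundle α h x₀ 0).2.Nonempty :=
  ⟨x₀, hx₀, by simp⟩

theorem steps_le : T.steps α h x₀ ≤ T.cuts := Nat.sInf_le (Or.inr rfl)

theorem nonempty_of_lt_steps (hx₀ : x₀ ∈ T.prob.X) {i : ℕ} (hi : i < T.steps α h x₀) :
    (T.bundle α h x₀ i).2.Nonempty := by
  rcases Nat.eq_zero_or_pos i with rfl | hi0
  · exact bundle_zero_nonempty hx₀
  · by_contra hcon
    exact absurd (Nat.sInf_le (Or.inl ⟨hi0, Set.not_nonempty_iff_eq_empty.1 hcon⟩))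
      (not_le.2 hi)

theorem steps_of_infeasible (hinf : T.infeasible α h x₀) :
    1 ≤ T.steps α h x₀ ∧ (T.bundle α h x₀ (T.steps α h x₀)).2 = ∅ := by
  obtain ⟨i, hi1, hi2, hi3⟩ := hinf
  have hmem : T.steps α h x₀ ∈ {i | 1 ≤ i ∧ (T.bundle α h x₀ i).2 = ∅} ∪ {T.cuts} :=
    Nat.sInf_mem ⟨T.cuts, Or.inr rfl⟩
  have hle : T.steps α h x₀ ≤ i := Nat.sInf_le (Or.inl ⟨hi1, hi3⟩)
  rcases hmem with hmem | hmem
  · exact hmem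
  · have : T.steps α h x₀ = i := le_antisymm hle (hi2.trans (ge_of_eq hmem))
    rw [this]
    exact ⟨hi1, hi3⟩

theorem nonempty_of_feasible (hx₀ : x₀ ∈ T.prob.X) (hinf : ¬ T.infeasible α h x₀) {i : ℕ}
    (hi : i ≤ T.cuts) : (T.bundle α h x₀ i).2.Nonempty := by
  rcases Nat.eq_zero_or_pos i with rfl | hi0
  · exact bundle_zero_nonempty hx₀
  · by_contra hcon
    exact hinf ⟨i, hi0, hi, Set.not_nonempty_iff_eq_empty.1 hcon⟩

theorem steps_of_feasible (hinf : ¬ T.infeasible α h x₀) : T.steps α h x₀ = T.cuts := by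
  have hmem : T.steps α h x₀ ∈ {i | 1 ≤ i ∧ (T.bundle α h x₀ i).2 = ∅} ∪ {T.cuts} :=
    Nat.sInf_mem ⟨T.cuts, Or.inr rfl⟩
  rcases hmem with hmem | hmem
  · exact absurd ⟨_, hmem.1, steps_le, hmem.2⟩ hinf
  · exact hmem

theorem solved_of_feasible (hinf : ¬ T.infeasible α h x₀) : T.solved α h x₀ = T.cuts := by
  rw [solved, if_neg hinf, steps_of_feasible hinf]

theorem mix_bundle_mem (hT : T.Valid k L) (hx₀ : x₀ ∈ T.prob.X) (hh : h ∈ T.prob.X)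
    (hα0 : 0 ≤ α) (hα1 : α ≤ 1) {i : ℕ} (hne : (T.bundle α h x₀ i).2.Nonempty) :
    mix α h (T.bundle α h x₀ i).1 ∈ T.prob.X :=
  mix_mem hT.convexOn.1 hα0 hα1 hh ((bundle_regular hT i).2.2 (bundle_spec hT hx₀ hne).1)

/-- Pigeonhole: `cuts + 1` mixed points, indices from `0` on, meet at most `k ≤ cuts` pieces. On a
shared piece smoothness compares `f` at the later point with the cut at the earlier one. That cut is
affine, at most `f h` at `h`, and at most `level` at the later iterate. -/
theorem exists_pair_gap_le (hT : T.Valid k L) (hx₀ : x₀ ∈ T.prob.X) (hh : h ∈ T.prob.X)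
    (hα0 : 0 ≤ α) (hα1 : α ≤ 1) (hinf : ¬ T.infeasible α h x₀) :
    ∃ l r, l < r ∧ r ≤ T.cuts ∧
      T.prob.f (mix α h (T.bundle α h x₀ r).1) - T.level ≤
        (1 - α) * (T.prob.f h - T.level) +
          L * (α ^ 2 / 2 * ‖(T.bundle α h x₀ r).1 - (T.bundle α h x₀ l).1‖ ^ 2) := by
  obtain ⟨-, piece, hpiece, hsm⟩ := hT.pws
  have hmem : ∀ i : Fin (T.cuts + 1), ∃ j, mix α h (T.bundle α h x₀ i).1 ∈ piece j := by
    intro i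
    have := mix_bundle_mem hT hx₀ hh hα0 hα1
      (nonempty_of_feasible (α := α) (h := h) hx₀ hinf (Nat.lt_succ_iff.1 i.2))
    rw [← hpiece] at this
    exact Set.mem_iUnion.1 this
  choose idx hidx using hmem
  have hpig : ∃ a b : Fin (T.cuts + 1), a < b ∧ idx a = idx b := by
    obtain ⟨a, b, hab, he⟩ := Fintype.exists_ne_map_eq_of_card_lt idx
      (by simpa using Nat.lt_succ_of_le hT.le_cuts)
    rcases lt_or_gt_of_ne hab with hlt | hlt
    · exact ⟨a, b, hlt, he⟩
    · exact ⟨b, a, hlt, he.symm⟩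
  obtain ⟨a, b, hab, he⟩ := hpig
  have hb : (b : ℕ) ≤ T.cuts := Nat.lt_succ_iff.1 b.2
  refine ⟨a, b, hab, hb, ?_⟩
  have hne := nonempty_of_feasible (α := α) (h := h) hx₀ hinf hb
  have hneA := nonempty_of_feasible (α := α) (h := h) hx₀ hinf (Nat.lt_succ_iff.1 a.2)
  -- The cut taken at index `a` is present in all localizers from `a + 1` on, hence in that of `b`.
  have hcut : T.prob.lin (T.bundle α h x₀ b).1 (mix α h (T.bundle α h x₀ a).1) ≤ T.level :=
    (bundle_antitone (T := T) (Nat.succ_le_of_lt hab) (bundle_spec hT hx₀ hne).1).2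
  have h1 := hsm (idx b) _ (hidx b) _ (he ▸ hidx a)
  rw [Problem.lin_mix, mix_sub_mix, norm_smul, Real.norm_of_nonneg hα0] at h1
  have h2 := hT.oracle _ (mix_bundle_mem hT hx₀ hh hα0 hα1 hneA) _ hh
  have h3 : (1 - α) * T.prob.lin h (mix α h (T.bundle α h x₀ a).1) ≤
      (1 - α) * T.prob.f h := by gcongr
  have h4 : α * T.prob.lin (T.bundle α h x₀ b).1 (mix α h (T.bundle α h x₀ a).1) ≤
      α * T.level := by gcongr
  rw [mul_pow] at h1
  linarith

end bundle

/-! ### Invariants carried across outer iterations. -/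

/-- What holds after `t` outer iterations without an infeasible subproblem. -/
structure Regular (T : LevelTask d) (L : ℝ) (t : ℕ) (S : LevelState d) : Prop where
  best_mem : S.best ∈ T.prob.X
  x_mem : S.x ∈ T.prob.X
  best_norm_le : ‖S.best - T.center‖ ≤ ‖S.x - T.center‖
  finite : S.points.Finite
  center_mem : T.center ∈ S.points
  subset : S.points ⊆ T.prob.X
  subset_ball : S.points ⊆ Metric.closedBall T.center ‖S.x - T.center‖
  -- Old cuts are forgotten by the method; this one half-space retains every point that satisfies
  -- all of them.
  halfspace : ∀ x ∈ T.prob.X, (∀ z ∈ S.points, T.prob.lin x z ≤ T.level) →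
    0 ≤ inner ℝ (x - S.x) (S.x - T.center)
  best_le : T.prob.f S.best ≤ T.prob.f T.center
  gap_le : omega t * (T.prob.f S.best - T.level) ≤ 3 * (T.prob.f T.center - T.level) + S.num
  num_nonneg : 0 ≤ S.num
  num_le : S.num ≤ 4 * L * S.den
  den_nonneg : 0 ≤ S.den
  den_le : S.den ≤ ‖S.x - T.center‖ ^ 2

theorem regular_zero (hT : T.Valid k L) : T.Regular L 0 (T.state 0) where
  best_mem := hT.center_mem
  x_mem := hT.center_mem
  best_norm_le := le_rfl
  finite := Set.finite_singleton _
  center_mem := rfl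
  subset := Set.singleton_subset_iff.2 hT.center_mem
  subset_ball := Set.singleton_subset_iff.2 (by simp)
  halfspace := fun x _ _ => by simp [state]
  best_le := le_rfl
  gap_le := by
    have h : omega 0 = 3 := by norm_num [omega]
    simp [state, h]
  num_nonneg := le_rfl
  num_le := by simp [state]
  den_nonneg := le_rfl
  den_le := by simp [state]

/-- A point below the level could be moved towards the center, staying in the level set but getting
strictly closer than `S.x`. The half-space containing the level set forbids this. -/
theorem Regular.level_le {t : ℕ} {S : LevelState d} (hS : T.Regular L t S) (hT : T.Valid k L)
    {x : Vec d} (hx : x ∈ T.prob.X) (hn : ‖x - T.center‖ ≤ ‖S.x - T.center‖) :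
    T.level ≤ T.prob.f x := by
  by_contra! hlt
  set a := T.prob.f T.center - T.level with ha
  set b := T.level - T.prob.f x with hb
  have ha0 : 0 < a := sub_pos.2 hT.level_lt
  have hb0 : 0 < b := sub_pos.2 hlt
  -- The weight for which the convexity bound on the segment from `x` to the center equals the
  -- level.
  set s := b / (a + b) with hs
  have hs0 : 0 < s := by positivity
  have hs1 : s ≤ 1 := (div_le_one (by positivity)).2 (by linarith)
  have hmem := mix_mem hT.convexOn.1 hs0.le hs1 hx hT.center_mem
  have hf : T.prob.f (mix s x T.center) ≤ T.level := by
    have h1 := convex_mix_le hT.convexOn hs0.le hs1 hx hT.center_mem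
    have h2 : (1 - s) * T.prob.f x + s * T.prob.f T.center = T.level + (s * (a + b) - b) := by
      rw [ha, hb]; ring
    rw [h2, hs, div_mul_cancel₀ _ (by positivity)] at h1
    linarith
  have h1 := norm_sq_add_le (hS.halfspace _ hmem fun z hz =>
    (hT.oracle z (hS.subset hz) _ hmem).trans hf)
  have h2 : ‖S.x - T.center‖ ≤ ‖mix s x T.center - T.center‖ := by
    refine le_of_sq_le_sq ?_ (norm_nonneg _)
    linarith [sq_nonneg ‖mix s x T.center - S.x‖]
  rw [norm_mix_right_sub hs1] at h2
  have h3 : ‖x - T.center‖ ≤ 0 := by nlinarith [norm_nonneg (x - T.center)]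
  have h4 : x = T.center := sub_eq_zero.1 (norm_le_zero_iff.1 h3)
  rw [h4] at hlt
  linarith [hT.level_lt]

end LevelTask
end RApex

/-! ### A single outer iteration: certificate at exit, progress, preservation of the invariants. -/

namespace RApex
namespace LevelTask

variable {d : ℕ} {T : LevelTask d} {k : ℕ} {L : ℝ}

theorem calls_oneStep_le (t : ℕ) (S : LevelState d) :
    (T.oneStep t S).calls ≤ S.calls + T.cuts :=
  Nat.add_le_add_left steps_le _

theorem calls_state_le (t : ℕ) : (T.state t).calls ≤ t * T.cuts := by
  induction t with
  | zero => simp [state]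
  | succ t ih =>
    have := calls_oneStep_le (T := T) (t + 1) (T.state t)
    rw [state, Nat.succ_mul]
    omega

theorem points_oneStep (t : ℕ) (S : LevelState d) : (T.oneStep t S).points =
    S.points ∪ ({T.center} ∪ {z | ∃ j, 1 ≤ j ∧ j ≤ T.steps (alpha t) S.best S.x ∧
      z = mix (alpha t) S.best (T.bundle (alpha t) S.best S.x (j - 1)).1}) := rfl

theorem finite_points_oneStep {t : ℕ} {S : LevelState d} (h : S.points.Finite) :
    (T.oneStep t S).points.Finite := by
  rw [points_oneStep]
  refine h.union ((Set.finite_singleton _).union ?_)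
  refine ((Set.finite_Iic (T.steps (alpha t) S.best S.x)).image fun j =>
    mix (alpha t) S.best (T.bundle (alpha t) S.best S.x (j - 1)).1).subset ?_
  rintro z ⟨j, -, hj, rfl⟩
  exact ⟨j, hj, rfl⟩

theorem subset_points_oneStep (t : ℕ) (S : LevelState d) :
    S.points ⊆ (T.oneStep t S).points := Set.subset_union_left

theorem mix_mem_points_oneStep {t : ℕ} {S : LevelState d} {i : ℕ}
    (hi : i < T.steps (alpha t) S.best S.x) :
    mix (alpha t) S.best (T.bundle (alpha t) S.best S.x i).1 ∈ (T.oneStep t S).points :=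
  Or.inr (Or.inr ⟨i + 1, by omega, hi, rfl⟩)

theorem points_oneStep_subset (hT : T.Valid k L) {t : ℕ} {S : LevelState d}
    (hS : T.Regular L t S) : (T.oneStep (t + 1) S).points ⊆ T.prob.X := by
  rw [points_oneStep]
  refine Set.union_subset hS.subset (Set.union_subset
    (Set.singleton_subset_iff.2 hT.center_mem) ?_)
  rintro z ⟨j, hj1, hj, rfl⟩
  exact mix_bundle_mem hT hS.x_mem hS.best_mem (alpha_nonneg _) (alpha_succ_le_one _)
    (nonempty_of_lt_steps hS.x_mem (by omega))

open Filter Topology in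
-- Any point of the ball strictly below the level in all retained cuts would, after a slight move
-- towards the center, be feasible and at distance less than `R`. The stopping event excludes such
-- points.
theorem Regular.ballCert (hT : T.Valid k L) {t : ℕ} {S : LevelState d} (hS : T.Regular L t S)
    {R : ℝ} (hR : 0 < R) (hx : ‖S.x - T.center‖ ≤ R)
    (hhalts : (T.oneStep (t + 1) S).flag ∨ R ≤ ‖(T.oneStep (t + 1) S).x - T.center‖) :
    T.prob.BallCert T.center R (T.prob.f T.center - T.level)
      ((T.oneStep (t + 1) S).points ∩ Metric.closedBall T.center R) := by
  set α := alpha (t + 1) with hα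
  have hα0 : 0 ≤ α := alpha_nonneg _
  have hα1 : α ≤ 1 := alpha_succ_le_one _
  set S' := T.oneStep (t + 1) S with hS'
  have hsub : S'.points ⊆ T.prob.X := points_oneStep_subset hT hS
  have hfin : (S'.points ∩ Metric.closedBall T.center R).Finite :=
    (finite_points_oneStep hS.finite).inter_of_left _
  refine ⟨hfin, ⟨subset_points_oneStep _ _ hS.center_mem, Metric.mem_closedBall_self hR.le⟩,
    Set.inter_subset_left.trans hsub, Set.inter_subset_right, fun x hxX hxR => ?_⟩
  -- The first such index `j` is what matters: all earlier iterates stay in the ball, so their cuts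
  -- survive the intersection with it, and later cuts are not needed.
  have hex : ∃ j, j ≤ T.steps α S.best S.x ∧ ((T.bundle α S.best S.x j).2 = ∅ ∨
      R ≤ ‖(T.bundle α S.best S.x j).1 - T.center‖) := by
    by_cases hinf : T.infeasible α S.best S.x
    · exact ⟨_, le_rfl, Or.inl (steps_of_infeasible hinf).2⟩
    · rcases hhalts with hflag | hfar
      · exact absurd hflag hinf
      · refine ⟨_, le_rfl, Or.inr ?_⟩
        have : S'.x = (T.bundle α S.best S.x (T.solved α S.best S.x)).1 := rfl
        rwa [this, solved_of_feasible hinf, ← steps_of_feasible hinf] at hfar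
  classical
  obtain ⟨hj, hjend⟩ := Nat.find_spec hex
  set j := Nat.find hex with hjdef
  have hbefore : ∀ i < j, (T.bundle α S.best S.x i).2.Nonempty ∧
      ‖(T.bundle α S.best S.x i).1 - T.center‖ ≤ R := by
    intro i hi
    have := Nat.find_min hex hi
    push Not at this
    obtain ⟨h1, h2⟩ := this (hi.le.trans hj)
    exact ⟨h1, h2.le⟩
  have hpt : ∀ i < j, mix α S.best (T.bundle α S.best S.x i).1 ∈
      S'.points ∩ Metric.closedBall T.center R := by
    intro i hi
    refine ⟨mix_mem_points_oneStep (hi.trans_le hj), ?_⟩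
    rw [Metric.mem_closedBall, dist_eq_norm]
    exact norm_mix_sub_le hα0 hα1 (hS.best_norm_le.trans hx) (hbefore i hi).2
  have hpt0 : S.points ⊆ S'.points ∩ Metric.closedBall T.center R := fun z hz =>
    ⟨subset_points_oneStep _ _ hz, Metric.closedBall_subset_closedBall hx (hS.subset_ball hz)⟩
  by_contra! hcon
  rw [sub_sub_cancel] at hcon
  -- Finitely many strict inequalities persist for small `s > 0`; the move makes the distance
  -- strictly smaller than `R`, while leaving the ball is only known as `R ≤`.
  have hev : ∀ z ∈ S'.points ∩ Metric.closedBall T.center R,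
      ∀ᶠ s in 𝓝[>] (0 : ℝ), T.prob.lin (mix s x T.center) z ≤ T.level := by
    intro z hz
    have hcont : Tendsto (fun s : ℝ => (1 - s) * T.prob.lin x z + s * T.prob.lin T.center z)
        (𝓝[>] 0) (𝓝 (T.prob.lin x z)) := by
      have : Continuous fun s : ℝ =>
          (1 - s) * T.prob.lin x z + s * T.prob.lin T.center z := by fun_prop
      exact tendsto_nhdsWithin_of_tendsto_nhds (by simpa using this.tendsto 0)
    filter_upwards [hcont.eventually (gt_mem_nhds (hcon z hz))] with s hs
    rw [Problem.lin_mix]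
    exact hs.le
  obtain ⟨s, hs, hs0, hs1⟩ := (((eventually_all_finite hfin).2 hev).and
    (Ioc_mem_nhdsGT (zero_lt_one' ℝ))).exists
  have hmem : mix s x T.center ∈ T.prob.X :=
    mix_mem hT.convexOn.1 hs0.le hs1 hxX hT.center_mem
  have hin : mix s x T.center ∈ (T.bundle α S.best S.x j).2 :=
    mem_bundle hmem (hS.halfspace _ hmem fun z hz => hs z (hpt0 hz)) fun i hi => hs _ (hpt i hi)
  rcases hjend with h0 | hfar
  · rw [h0] at hin
    exact hin
  · have h1 := norm_sq_add_le ((bundle_spec hT hS.x_mem ⟨_, hin⟩).2 _ hin)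
    have h2 : R ≤ ‖mix s x T.center - T.center‖ := by
      refine hfar.trans (le_of_sq_le_sq ?_ (norm_nonneg _))
      linarith [sq_nonneg ‖mix s x T.center - (T.bundle α S.best S.x j).1‖]
    rw [norm_mix_right_sub hs1] at h2
    nlinarith

theorem best_oneStep_spec (hT : T.Valid k L) (t : ℕ) (S : LevelState d) :
    ((T.oneStep t S).best = S.best ∨ ∃ j, 1 ≤ j ∧ j ≤ T.solved (alpha t) S.best S.x ∧
      (T.oneStep t S).best = mix (alpha t) S.best (T.bundle (alpha t) S.best S.x j).1) ∧
    T.prob.f (T.oneStep t S).best ≤ T.prob.f S.best ∧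
    ∀ j, 1 ≤ j → j ≤ T.solved (alpha t) S.best S.x → T.prob.f (T.oneStep t S).best ≤
      T.prob.f (mix (alpha t) S.best (T.bundle (alpha t) S.best S.x j).1) := by
  have hfin : ({S.best} ∪ {z | ∃ j, 1 ≤ j ∧ j ≤ T.solved (alpha t) S.best S.x ∧
      z = mix (alpha t) S.best (T.bundle (alpha t) S.best S.x j).1}).Finite := by
    refine (Set.finite_singleton _).union (((Set.finite_Iic
      (T.solved (alpha t) S.best S.x)).image fun j =>
      mix (alpha t) S.best (T.bundle (alpha t) S.best S.x j).1).subset ?_)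
    rintro z ⟨j, -, hj, rfl⟩
    exact ⟨j, hj, rfl⟩
  obtain ⟨h1, h2⟩ := hT.pick_spec t _ hfin ⟨S.best, Or.inl rfl⟩
  exact ⟨h1, h2 _ (Or.inl rfl), fun j hj1 hj2 => h2 _ (Or.inr ⟨j, hj1, hj2, rfl⟩)⟩

/-- The terms that outer iteration `t` contributes to `num` and `den`. -/
theorem exists_increment (hT : T.Valid k L) {t : ℕ} {S : LevelState d}
    (hS : T.Regular L t S) (hinf : ¬ T.infeasible (alpha (t + 1)) S.best S.x) :
    ∃ a D : ℝ, (T.oneStep (t + 1) S).num = S.num + a ∧ (T.oneStep (t + 1) S).den = S.den + D ∧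
      0 ≤ a ∧ a ≤ 4 * L * D ∧ 0 ≤ D ∧
      D ≤ ‖(T.oneStep (t + 1) S).x - T.center‖ ^ 2 - ‖S.x - T.center‖ ^ 2 ∧
      omega (t + 1) * (T.prob.f (T.oneStep (t + 1) S).best - T.level) ≤
        omega t * (T.prob.f S.best - T.level) + a := by
  have hbest := best_oneStep_spec hT (t + 1) S
  have hx' : (T.oneStep (t + 1) S).x = (T.bundle (alpha (t + 1)) S.best S.x T.cuts).1 := by
    rw [← solved_of_feasible hinf]; rfl
  rw [hx']
  have hmono : ∀ l r, l ≤ r → r ≤ T.cuts →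
      ‖(T.bundle (alpha (t + 1)) S.best S.x l).1 - T.center‖ ^ 2 +
        ‖(T.bundle (alpha (t + 1)) S.best S.x r).1 -
          (T.bundle (alpha (t + 1)) S.best S.x l).1‖ ^ 2 ≤
        ‖(T.bundle (alpha (t + 1)) S.best S.x r).1 - T.center‖ ^ 2 := fun l r hl hr =>
    bundle_norm_sq_add_le hT hS.x_mem hl (nonempty_of_feasible hS.x_mem hinf hr)
  have hx0 : (T.bundle (alpha (t + 1)) S.best S.x 0).1 = S.x := rfl
  have htot := hmono 0 T.cuts (Nat.zero_le _) le_rfl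
  rw [hx0] at htot
  have hω := omega_succ_mul t
  have hω0 := omega_pos (t + 1)
  have hωα := omega_mul_alpha_sq_le (t + 1)
  have hα0 := alpha_pos (t + 1)
  have hα1 := alpha_succ_le_one t
  obtain ⟨l, r, hlr, hr, hpair⟩ :=
    exists_pair_gap_le hT hS.x_mem hS.best_mem hα0.le hα1 hinf
  have hbr := hbest.2.2 r (by omega) (by rw [solved_of_feasible hinf]; exact hr)
  have hbb := hbest.2.1
  set S' := T.oneStep (t + 1) S with hS'
  set x : ℕ → Vec d := fun i => (T.bundle (alpha (t + 1)) S.best S.x i).1 with hx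
  set α := alpha (t + 1)
  set gO := T.prob.f S.best - T.level with hgO
  set gN := T.prob.f S'.best - T.level with hgN
  set e := gN - (1 - 3 / 4 * α) * gO with he
  set q := bestPair T.cuts e α x with hq
  -- Only slow iterations are charged. There `gO > 0`, because `gN ≤ gO`, and `e > α / 4 * gO > 0`.
  by_cases hslow : gN > (1 - α / 2) * gO
  · have hpos : 0 < gO := by
      have : gN ≤ gO := by linarith
      by_contra! hc
      nlinarith
    -- If the paired iterates coincided, the pigeonhole bound would give `gN ≤ (1 - α) * gO`,
    -- contradicting slowness.
    have hne : x r ≠ x l := by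
      intro hrl
      have h0 : ‖x r - x l‖ = 0 := by rw [hrl, sub_self, norm_zero]
      simp only [hx] at h0
      rw [h0] at hpair
      nlinarith
    have hmem : ((r, l) : ℕ × ℕ) ∈ pairs T.cuts x := ⟨hlr, hr, hne⟩
    obtain ⟨hqm, hqmin⟩ := bestPair_spec (e := e) (α := α) ⟨_, hmem⟩
    rw [← hq] at hqm hqmin
    have hDpos : 0 < ‖x q.1 - x q.2‖ ^ 2 := by
      have := norm_pos_iff.2 (sub_ne_zero.2 hqm.2.2)
      positivity
    have hDpos' : 0 < ‖x r - x l‖ ^ 2 := by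
      have := norm_pos_iff.2 (sub_ne_zero.2 hne)
      positivity
    have he0 : 0 < e := by rw [he]; nlinarith
    -- The pigeonhole pair competes in the minimum, and `e ≤ gN - (1 - α) * gO`, so its ratio is at
    -- most `L`.
    have hL : ratio e α x q ≤ L := by
      refine (hqmin _ hmem).trans ?_
      unfold ratio
      rw [div_le_iff₀ (by positivity)]
      simp only [hx] at *
      rw [he]
      nlinarith
    have hL0 : 0 ≤ ratio e α x q := by unfold ratio; positivity
    have hLe : ratio e α x q * (α ^ 2 / 2 * ‖x q.1 - x q.2‖ ^ 2) = e := by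
      unfold ratio
      rw [div_mul_cancel₀]
      positivity
    refine ⟨omega (t + 1) * α ^ 2 * ratio e α x q * ‖x q.1 - x q.2‖ ^ 2 / 2,
      ‖x q.1 - x q.2‖ ^ 2, ?_, ?_, by positivity, ?_, by positivity, ?_, ?_⟩
    · exact congrArg (S.num + ·) (if_pos hslow)
    · exact congrArg (S.den + ·) (if_pos hslow)
    · have : omega (t + 1) * α ^ 2 * ratio e α x q ≤ 8 * L := by gcongr
      nlinarith
    -- Norms to the center increase along `0 ≤ q.2 < q.1 ≤ cuts`, so the selected squared
    -- displacement fits into the total increase.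
    · have h1 := hmono q.2 q.1 hqm.1.le hqm.2.1
      have h2 := hmono 0 q.2 (Nat.zero_le _) (hqm.1.le.trans hqm.2.1)
      have h3 := hmono q.1 T.cuts hqm.2.1 le_rfl
      rw [hx0] at h2
      simp only [hx]
      linarith [sq_nonneg ‖(T.bundle α S.best S.x q.2).1 - S.x‖,
        sq_nonneg ‖(T.bundle α S.best S.x T.cuts).1 - (T.bundle α S.best S.x q.1).1‖]
    · have h1 : omega (t + 1) * α ^ 2 * ratio e α x q * ‖x q.1 - x q.2‖ ^ 2 / 2 =
          omega (t + 1) * (ratio e α x q * (α ^ 2 / 2 * ‖x q.1 - x q.2‖ ^ 2)) := by ring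
      have h2 : 0 ≤ omega (t + 1) * (α * gO) := by positivity
      have h3 : omega (t + 1) * e = omega (t + 1) * (gN - (1 - 3 / 4 * α) * gO) := by rw [he]
      rw [h1, hLe, h3, ← hω]
      linarith
  · refine ⟨0, 0, ?_, ?_, le_rfl, by simp, le_rfl, ?_, ?_⟩
    · exact congrArg (S.num + ·) (if_neg hslow)
    · exact congrArg (S.den + ·) (if_neg hslow)
    · linarith [sq_nonneg ‖(T.bundle α S.best S.x T.cuts).1 - S.x‖]
    · rw [← hω, add_zero, mul_assoc]
      exact mul_le_mul_of_nonneg_left (not_lt.1 hslow) hω0.le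

theorem Regular.oneStep (hT : T.Valid k L) {t : ℕ} {S : LevelState d} (hS : T.Regular L t S)
    (hflag : ¬ (T.oneStep (t + 1) S).flag) :
    T.Regular L (t + 1) (T.oneStep (t + 1) S) := by
  have hinf : ¬ T.infeasible (alpha (t + 1)) S.best S.x := hflag
  have hα0 := alpha_nonneg (t + 1)
  have hα1 := alpha_succ_le_one t
  have hx' : (T.oneStep (t + 1) S).x = (T.bundle (alpha (t + 1)) S.best S.x T.cuts).1 := by
    rw [← solved_of_feasible hinf]; rfl
  have hne : ∀ i ≤ T.cuts, (T.bundle (alpha (t + 1)) S.best S.x i).2.Nonempty := fun i hi =>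
    nonempty_of_feasible hS.x_mem hinf hi
  have hnorm : ∀ i ≤ T.cuts, ‖(T.bundle (alpha (t + 1)) S.best S.x i).1 - T.center‖ ≤
      ‖(T.oneStep (t + 1) S).x - T.center‖ := fun i hi => by
    rw [hx']; exact bundle_norm_le hT hS.x_mem hi (hne _ le_rfl)
  have hnorm0 : ‖S.x - T.center‖ ≤ ‖(T.oneStep (t + 1) S).x - T.center‖ :=
    hnorm 0 (Nat.zero_le _)
  have hnmix : ∀ i ≤ T.cuts,
      ‖mix (alpha (t + 1)) S.best (T.bundle (alpha (t + 1)) S.best S.x i).1 - T.center‖ ≤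
      ‖(T.oneStep (t + 1) S).x - T.center‖ := fun i hi =>
    norm_mix_sub_le hα0 hα1 (hS.best_norm_le.trans hnorm0) (hnorm i hi)
  have hmixm : ∀ i ≤ T.cuts,
      mix (alpha (t + 1)) S.best (T.bundle (alpha (t + 1)) S.best S.x i).1 ∈ T.prob.X :=
    fun i hi => mix_bundle_mem hT hS.x_mem hS.best_mem hα0 hα1 (hne i hi)
  obtain ⟨hb1, hb2, -⟩ := best_oneStep_spec hT (t + 1) S
  rw [solved_of_feasible hinf] at hb1
  obtain ⟨a, D, hnum, hden, ha0, haD, hD0, hDle, hgap⟩ := exists_increment hT hS hinf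
  refine ⟨?_, ?_, ?_, finite_points_oneStep hS.finite,
    subset_points_oneStep _ _ hS.center_mem, points_oneStep_subset hT hS, ?_, ?_,
    hb2.trans hS.best_le, ?_, ?_, ?_, ?_, ?_⟩
  · rcases hb1 with h | ⟨j, -, hj, h⟩
    · rw [h]; exact hS.best_mem
    · rw [h]; exact hmixm j hj
  · rw [hx']
    exact (bundle_regular hT _).2.2 (bundle_spec hT hS.x_mem (hne _ le_rfl)).1
  · rcases hb1 with h | ⟨j, -, hj, h⟩
    · rw [h]; exact hS.best_norm_le.trans hnorm0
    · rw [h]; exact hnmix j hj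
  · rw [points_oneStep]
    refine Set.union_subset (hS.subset_ball.trans (Metric.closedBall_subset_closedBall hnorm0))
      (Set.union_subset (Set.singleton_subset_iff.2 (by simp)) ?_)
    rintro z ⟨j, hj1, hj, rfl⟩
    rw [Metric.mem_closedBall, dist_eq_norm]
    rw [steps_of_feasible hinf] at hj
    exact hnmix _ (by omega)
  · intro x hx hcut
    rw [hx']
    refine (bundle_spec hT hS.x_mem (hne _ le_rfl)).2 _ (mem_bundle hx
      (hS.halfspace x hx fun z hz => hcut z (subset_points_oneStep _ _ hz)) fun i hi => ?_)
    exact hcut _ (mix_mem_points_oneStep (by rwa [steps_of_feasible hinf]))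
  · rw [hnum]; linarith [hS.gap_le]
  · rw [hnum]; linarith [hS.num_nonneg]
  · rw [hnum, hden]; linarith [hS.num_le]
  · rw [hden]; linarith [hS.den_nonneg]
  · rw [hden]; linarith [hS.den_le]

theorem regular_state (hT : T.Valid k L) (t : ℕ) (h : ∀ i, 1 ≤ i → i ≤ t → ¬ (T.state i).flag) :
    T.Regular L t (T.state t) := by
  induction t with
  | zero => exact regular_zero hT
  | succ t ih =>
    exact (ih fun i h1 h2 => h i h1 (by omega)).oneStep hT (h (t + 1) (by omega) le_rfl)

theorem Regular.avgL_nonneg {t : ℕ} {S : LevelState d} (hS : T.Regular L t S) : 0 ≤ S.avgL :=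
  div_nonneg hS.num_nonneg hS.den_nonneg

theorem Regular.avgL_le (hL : 0 ≤ L) {t : ℕ} {S : LevelState d} (hS : T.Regular L t S) :
    S.avgL ≤ 4 * L :=
  div_le_of_le_mul₀ hS.den_nonneg (by positivity) hS.num_le

/-- The convergence estimate in computable quantities: `num = avgL * den`, with `den` at most the
squared distance travelled. -/
theorem Regular.gap_le_avgL {t : ℕ} {S : LevelState d} (hS : T.Regular L t S) :
    omega t * (T.prob.f S.best - T.level) ≤
      3 * (T.prob.f T.center - T.level) + S.avgL * ‖S.x - T.center‖ ^ 2 := by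
  have h1 : S.num ≤ S.avgL * ‖S.x - T.center‖ ^ 2 := by
    -- For `den = 0` the quotient `avgL` is `0` by convention, and `num ≤ 4 * L * den` makes `num`
    -- vanish too.
    rcases hS.den_nonneg.eq_or_lt with h0 | h0
    · have := hS.num_le
      rw [← h0, mul_zero] at this
      have := hS.avgL_nonneg
      exact le_trans ‹S.num ≤ 0› (by positivity)
    · calc S.num = S.avgL * S.den := (div_mul_cancel₀ _ h0.ne').symm
        _ ≤ _ := mul_le_mul_of_nonneg_left hS.den_le hS.avgL_nonneg
  linarith [hS.gap_le]

end LevelTask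
-- Termination and correctness of the two subroutines.
theorem firstStop_spec {halts : ℕ → Prop} {t₀ : ℕ} (h₀ : 1 ≤ t₀) (h : halts t₀) :
    ∃ t, firstStop halts = some t ∧ 1 ≤ t ∧ t ≤ t₀ ∧ halts t ∧
      ∀ i, 1 ≤ i → i < t → ¬ halts i := by
  classical
  have hex : ∃ t, 1 ≤ t ∧ halts t := ⟨t₀, h₀, h⟩
  refine ⟨Nat.find hex, ?_, (Nat.find_spec hex).1, Nat.find_min' hex ⟨h₀, h⟩,
    (Nat.find_spec hex).2, fun i hi hlt hh => Nat.find_min hex hlt ⟨hi, hh⟩⟩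
  unfold firstStop
  rw [dif_pos hex]

/-- The assumptions on a problem under which the level runs behave well. -/
structure Problem.Admissible {d : ℕ} (p : Problem d) (k m : ℕ) (L : ℝ) : Prop where
  closed : IsClosed p.X
  convexOn : ConvexOn ℝ p.X p.f
  oracle : p.IsSubgradientOracle
  pws : p.IsPWS k L
  le_cuts : k ≤ m

variable {d : ℕ} {p : Problem d} {k m : ℕ} {L : ℝ} {pick : ℕ → Set (Vec d) → Vec d}

theorem Problem.Admissible.valid (hp : p.Admissible k m L)
    (hpick : ∀ t, ∀ S : Set (Vec d), S.Finite → S.Nonempty →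
      pick t S ∈ S ∧ ∀ z ∈ S, p.f (pick t S) ≤ p.f z) {y : Vec d} (hy : y ∈ p.X) {l : ℝ}
    (hl : l < p.f y) :
    LevelTask.Valid { prob := p, center := y, level := l, cuts := m, pick := pick } k L :=
  ⟨hp.closed, hp.convexOn, hp.oracle, hp.pws, hp.le_cuts, hy, hl, hpick⟩

/-- Since `avgL ≤ 4 * L`, the iteration-count test must fire by `t₀`. On failure `best` witnesses
that `Δ` underestimates the gap, which later shows that the guess was too large. -/
theorem awg_spec (hp : p.Admissible k m L)
    (hpick : ∀ t, ∀ S : Set (Vec d), S.Finite → S.Nonempty →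
      pick t S ∈ S ∧ ∀ z ∈ S, p.f (pick t S) ≤ p.f z) {y : Vec d} (hy : y ∈ p.X)
    {Δ β μ : ℝ} (hΔ : 0 < Δ) (hβ : 0 < β) (hμ : 0 < μ) {t₀ : ℕ} (ht₀ : 1 ≤ t₀)
    (hbound : 16 * L * (1 + β) / (μ * β) + 6 * (1 + β) / β ≤ (t₀ : ℝ) ^ 2) :
    ∃ r, awg p pick y Δ m √(2 * (1 + β) * Δ / μ) β = some r ∧ r.calls ≤ t₀ * m ∧
      (r.success → p.BallCert y √(2 * (1 + β) * Δ / μ) ((1 + β) * Δ) r.points) ∧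
      (¬ r.success → ∃ x ∈ p.X, p.f x < p.f y - Δ) := by
  set ι := √(2 * (1 + β) * Δ / μ) with hι
  have hι0 : 0 < ι := Real.sqrt_pos.2 (by positivity)
  have hιsq : ι ^ 2 = 2 * (1 + β) * Δ / μ := Real.sq_sqrt (by positivity)
  set T : LevelTask d :=
    { prob := p, center := y, level := p.f y - (1 + β) * Δ, cuts := m, pick := pick } with hTdef
  have hlev : 0 < (1 + β) * Δ := by positivity
  have hT : T.Valid k L := hp.valid hpick hy (by linarith)
  have hL : 0 ≤ L := hp.pws.1.le
  set accept : ℕ → Prop := fun t => (T.state t).flag ∨ ι < ‖(T.state t).x - y‖ with hacc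
  set reject : ℕ → Prop := fun t =>
    (T.state t).avgL * ‖(T.state t).x - y‖ ^ 2 < omega t * β * Δ - 3 * (1 + β) * Δ ∨
      √((2 * ι ^ 2 * (T.state t).avgL + 6 * (1 + β) * Δ) / (β * Δ)) ≤ (t : ℝ) with hrej
  have hreg : ∀ t, (∀ i, 1 ≤ i → i ≤ t → ¬ accept i) → T.Regular L t (T.state t) := fun t h =>
    LevelTask.regular_state hT t fun i h1 h2 hf => h i h1 h2 (Or.inl hf)
  have hex : ∃ t₁, 1 ≤ t₁ ∧ t₁ ≤ t₀ ∧ (accept t₁ ∨ reject t₁) := by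
    by_contra! hcon
    have hR := hreg t₀ fun i h1 h2 => (hcon i h1 h2).1
    refine (hcon t₀ ht₀ le_rfl).2 (Or.inr ?_)
    refine Real.sqrt_le_iff.2 ⟨by positivity, le_trans ?_ hbound⟩
    rw [hιsq, div_le_iff₀ (by positivity)]
    have h1 := hR.avgL_le hL
    calc 2 * (2 * (1 + β) * Δ / μ) * (T.state t₀).avgL + 6 * (1 + β) * Δ
        ≤ 2 * (2 * (1 + β) * Δ / μ) * (4 * L) + 6 * (1 + β) * Δ := by gcongr
      _ = _ := by field_simp; ring
  obtain ⟨t₁, h1, h2, h3⟩ := hex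
  obtain ⟨t, hhalts, ht1, htle, hhalt, hbefore⟩ :=
    firstStop_spec (halts := fun t => accept t ∨ reject t) h1 h3
  refine ⟨_, congrArg (Option.map _) hhalts, ?_, fun hs => ?_, fun hs => ?_⟩
  · exact (LevelTask.calls_state_le (T := T) t).trans (Nat.mul_le_mul_right m (htle.trans h2))
  -- The certificate is read off the last iteration, which starts from a regular state still inside
  -- the ball.
  · obtain ⟨u, rfl⟩ : ∃ u, t = u + 1 := ⟨t - 1, by omega⟩
    have hR := hreg u fun i hi1 hi2 hi => hbefore i hi1 (by omega) (Or.inl hi)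
    have hx : ‖(T.state u).x - T.center‖ ≤ ι := by
      rcases Nat.eq_zero_or_pos u with rfl | hu
      · simpa [LevelTask.state] using hι0.le
      · exact not_lt.1 fun hi => hbefore u hu (by omega) (Or.inl (Or.inr hi))
    have := hR.ballCert hT hι0 hx (hs.imp_right le_of_lt)
    rwa [show T.prob.f T.center - T.level = (1 + β) * Δ from sub_sub_cancel _ _] at this
  · have hna : ¬ accept t := hs
    have hR := hreg t fun i hi1 hi2 hi => by
      rcases hi2.eq_or_lt with rfl | hlt
      · exact hna hi
      · exact hbefore i hi1 hlt (Or.inl hi)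
    have hx : ‖(T.state t).x - y‖ ≤ ι := not_lt.1 fun hi => hna (Or.inr hi)
    have hLn := hR.avgL_nonneg
    -- Both rejection tests lead to the first inequality: the second implies it because `t ^ 2 / 2 <
    -- omega t` and the iterate is within `ι`.
    have hmain : (T.state t).avgL * ‖(T.state t).x - y‖ ^ 2 <
        omega t * β * Δ - 3 * (1 + β) * Δ := by
      rcases hhalt.resolve_left hna with h | h
      · exact h
      · have h4 := (Real.sqrt_le_iff.1 h).2
        rw [div_le_iff₀ (by positivity)] at h4
        have h5 : (T.state t).avgL * ‖(T.state t).x - y‖ ^ 2 ≤ (T.state t).avgL * ι ^ 2 := by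
          gcongr
        have h6 : (t : ℝ) ^ 2 / 2 * (β * Δ) < omega t * (β * Δ) := by
          have := sq_div_two_lt_omega t
          gcongr
        linarith
    have hgap : omega t * (p.f (T.state t).best - (p.f y - (1 + β) * Δ)) ≤
      3 * (p.f y - (p.f y - (1 + β) * Δ)) +
        (T.state t).avgL * ‖(T.state t).x - y‖ ^ 2 := hR.gap_le_avgL
    refine ⟨(T.state t).best, hR.best_mem, ?_⟩
    have h7 : omega t * (p.f (T.state t).best - (p.f y - (1 + β) * Δ)) < omega t * (β * Δ) := by
      linarith
    have h8 := lt_of_mul_lt_mul_left h7 (omega_pos t).le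
    linarith

/-- Success is unconditional: the iteration limit is such that, if the iterate is still near, the
convergence estimate already yields descent. Hence only `awg` ever lowers the guess. -/
theorem agr_spec (hp : p.Admissible k m L)
    (hpick : ∀ t, ∀ S : Set (Vec d), S.Finite → S.Nonempty →
      pick t S ∈ S ∧ ∀ z ∈ S, p.f (pick t S) ≤ p.f z) {y : Vec d} (hy : y ∈ p.X)
    {Δ θ μ : ℝ} (hΔ : 0 < Δ) (hθ : 1 / 2 < θ) (hμ : 0 < μ) {t₀ : ℕ} (ht₀ : 1 ≤ t₀)
    (hbound : √(6 * θ / (2 * θ - 1) + 16 * L * θ / (μ * (2 * θ - 1))) ≤ t₀) :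
    ∃ r, agr p pick (p.f y - Δ) Δ y μ θ m = some r ∧ r.calls ≤ t₀ * m ∧ r.success ∧
      (¬ r.upper → p.BallCert y √(2 * θ * Δ / μ) (θ * Δ) r.points) ∧
      (r.upper → r.best ∈ p.X ∧ p.f r.best ≤ p.f y ∧ p.f y - θ * Δ ≤ p.f r.best ∧
        p.f r.best - (p.f y - Δ) ≤ θ * Δ) := by
  have hθ0 : 0 < θ := by linarith
  have hθ1 : 0 < 2 * θ - 1 := by linarith
  set R := √(2 * θ * Δ / μ) with hR
  have hR0 : 0 < R := Real.sqrt_pos.2 (by positivity)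
  have hRsq : R ^ 2 = 2 * θ * Δ / μ := Real.sq_sqrt (by positivity)
  set T : LevelTask d :=
    { prob := p, center := y, level := p.f y - θ * Δ, cuts := m, pick := pick } with hTdef
  have hlev : 0 < θ * Δ := by positivity
  have hT : T.Valid k L := hp.valid hpick hy (by linarith)
  have hL : 0 ≤ L := hp.pws.1.le
  set far : ℕ → Prop := fun t =>
    (T.state t).flag ∨ 2 * θ * Δ / μ ≤ ‖(T.state t).x - y‖ ^ 2 with hfar
  set descent : ℕ → Prop := fun t => p.f (T.state t).best - (p.f y - Δ) ≤ θ * Δ with hdes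
  set late : ℕ → Prop := fun t =>
    ⌈√(6 * θ / (2 * θ - 1) + 4 * (T.state t).avgL * θ / (μ * (2 * θ - 1)))⌉₊ ≤ t with hlate
  have hreg : ∀ t, (∀ i, 1 ≤ i → i ≤ t → ¬ far i) → T.Regular L t (T.state t) := fun t h =>
    LevelTask.regular_state hT t fun i h1 h2 hf => h i h1 h2 (Or.inl hf)
  have hex : ∃ t₁, 1 ≤ t₁ ∧ t₁ ≤ t₀ ∧ (far t₁ ∨ descent t₁ ∨ late t₁) := by
    by_contra! hcon
    have hRg := hreg t₀ fun i h1 h2 => (hcon i h1 h2).1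
    refine (hcon t₀ ht₀ le_rfl).2.2 (Nat.ceil_le.2 (le_trans (Real.sqrt_le_sqrt ?_) hbound))
    have h1 := hRg.avgL_le hL
    have h2 : 16 * L * θ / (μ * (2 * θ - 1)) = 4 * (4 * L) * θ / (μ * (2 * θ - 1)) := by ring
    rw [h2]
    gcongr
  obtain ⟨t₁, h1, h2, h3⟩ := hex
  obtain ⟨t, hhalts, ht1, htle, hhalt, hbefore⟩ :=
    firstStop_spec (halts := fun t => far t ∨ descent t ∨ late t) h1 h3
  have hregt : ¬ far t → T.Regular L t (T.state t) := fun hnf => hreg t fun i hi1 hi2 hi => by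
    rcases hi2.eq_or_lt with rfl | hlt
    · exact hnf hi
    · exact hbefore i hi1 hlt (Or.inl hi)
  have hdesc : ¬ far t → descent t := by
    intro hnf
    rcases hhalt.resolve_left hnf with h | h
    · exact h
    · have hRg := hregt hnf
      have hx : ‖(T.state t).x - y‖ ^ 2 ≤ 2 * θ * Δ / μ := not_lt.1 fun hi =>
        hnf (Or.inr hi.le)
      have h4 := (Real.sqrt_le_iff.1 (Nat.ceil_le.1 h)).2
      have hgap : omega t * (p.f (T.state t).best - (p.f y - θ * Δ)) ≤
        3 * (p.f y - (p.f y - θ * Δ)) +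
          (T.state t).avgL * ‖(T.state t).x - y‖ ^ 2 := hRg.gap_le_avgL
      have hLn := hRg.avgL_nonneg
      have h5 : (T.state t).avgL * ‖(T.state t).x - y‖ ^ 2 ≤
          (T.state t).avgL * (2 * θ * Δ / μ) := by gcongr
      -- The limit is tuned to reach level gap `(2 * θ - 1) * Δ`, which is descent since the level
      -- lies `(1 - θ) * Δ` above the lower estimate.
      have h6 : 3 * (θ * Δ) + (T.state t).avgL * (2 * θ * Δ / μ) =
          (6 * θ / (2 * θ - 1) + 4 * (T.state t).avgL * θ / (μ * (2 * θ - 1))) / 2 *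
            ((2 * θ - 1) * Δ) := by
        generalize 2 * θ - 1 = c at hθ1
        field_simp
        ring
      have h7 : (6 * θ / (2 * θ - 1) + 4 * (T.state t).avgL * θ / (μ * (2 * θ - 1))) / 2 *
          ((2 * θ - 1) * Δ) ≤ omega t * ((2 * θ - 1) * Δ) := by
        have := sq_div_two_lt_omega t
        gcongr
        linarith
      have h8 : omega t * (p.f (T.state t).best - (p.f y - θ * Δ)) ≤
          omega t * ((2 * θ - 1) * Δ) := by linarith
      have h9 := le_of_mul_le_mul_left h8 (omega_pos t)
      simp only [hdes]
      linarith
  refine ⟨_, congrArg (Option.map _) hhalts, ?_, ?_, fun hs => ?_, fun hs => ?_⟩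
  · exact (LevelTask.calls_state_le (T := T) t).trans (Nat.mul_le_mul_right m (htle.trans h2))
  · exact (em (far t)).imp_right hdesc
  · have hf : far t := not_not.1 hs
    obtain ⟨u, rfl⟩ : ∃ u, t = u + 1 := ⟨t - 1, by omega⟩
    have hRg := hreg u fun i hi1 hi2 hi => hbefore i hi1 (by omega) (Or.inl hi)
    have hx : ‖(T.state u).x - T.center‖ ≤ R := by
      rcases Nat.eq_zero_or_pos u with rfl | hu
      · simpa [LevelTask.state] using hR0.le
      · refine Real.le_sqrt_of_sq_le ?_
        exact not_lt.1 fun hi => hbefore u hu (by omega) (Or.inl (Or.inr hi.le))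
    have := hRg.ballCert hT hR0 hx (hf.imp_right fun hi =>
      Real.sqrt_le_iff.2 ⟨norm_nonneg _, hi⟩)
    rwa [show T.prob.f T.center - T.level = θ * Δ from sub_sub_cancel _ _] at this
  · have hnf : ¬ far t := hs
    have hRg := hregt hnf
    -- `level_le` keeps `best` above the level, so the next gap estimate remains positive.
    exact ⟨hRg.best_mem, hRg.best_le, hRg.level_le hT hRg.best_mem hRg.best_norm_le, hdesc hnf⟩

/-! ### Potential and invariant of the restarted method. -/

/-- An upper bound for `μ̂ Δ̃` after `F` wrong guesses and `N` gap reductions. -/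
noncomputable def potential {d : ℕ} (p : Problem d) (θ β : ℝ) (y₀ : Vec d) (F N : ℕ) : ℝ :=
  2 * ‖p.g y₀‖ ^ 2 * (9 * (1 + β) / (4 * θ)) ^ F * θ ^ N

/-- The invariant of the restarted method after `n` subroutine calls, `F` of which revealed a wrong
guess and `N` of which were gap reductions. Every subroutine makes at most `M` oracle calls, and
no certificate of accuracy `ε` has been met so far. -/
structure RunInvariant {d : ℕ} (p : Problem d) (θ β μ ε : ℝ) (y₀ : Vec d) (muHat₁ : ℝ) (M : ℕ)
    (n F N : ℕ) (S : RState d) : Prop where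
  y_mem : S.y ∈ p.X
  gap_pos : 0 < S.gap
  low_eq : S.low = p.f S.y - S.gap
  muHat_eq : S.muHat = muHat₁ / 4 ^ F
  lt_muHat : μ / 4 < S.muHat
  valid : S.muHat ≤ μ → p.f S.y - p.optVal ≤ S.gap
  muHat_mul_gap_le : S.muHat * S.gap ≤ potential p θ β y₀ F N
  calls_le : S.calls ≤ 1 + F + n * M
  not_met : N = 0 ∨ ε ^ 2 * θ < 2 * (1 + β) * potential p θ β y₀ F N
  generate : S.phase = .generate → n ≤ F + 2 * N ∧
    ((S.prev = none ∧ S.y = y₀ ∧ N = 0) ∨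
      ∃ a b, S.prev = some (a, b) ∧ 0 < a ∧ 0 < b ∧ S.muHat ≤ a ∧
        p.f S.y - p.optVal ≤ max 1 (a / μ) * b ∧
        a * b ≤ (1 + β) / θ * potential p θ β y₀ F N)
  reduce : S.phase = .reduce → n ≤ F + 2 * N + 1 ∧ S.mu = S.muHat ∧ 0 < S.delta ∧
    S.delta ≤ (1 + β) * S.gap ∧ p.BallCert S.y √(2 * S.delta / S.mu) S.delta S.points

section

variable {d : ℕ} {p : Problem d} {k m : ℕ} {L : ℝ} {pick : ℕ → Set (Vec d) → Vec d}
  {θ β μ ε muHat₁ : ℝ} {y₀ : Vec d} {M n F N : ℕ} {S : RState d}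

theorem potential_nonneg (hθ : 0 < θ) (hβ : 0 < β) : 0 ≤ potential p θ β y₀ F N := by
  unfold potential; positivity

theorem potential_succ_left : potential p θ β y₀ (F + 1) N =
    9 * (1 + β) / (4 * θ) * potential p θ β y₀ F N := by
  unfold potential; ring

theorem potential_succ_right : potential p θ β y₀ F (N + 1) =
    θ * potential p θ β y₀ F N := by
  unfold potential; ring

theorem one_lt_potential_base (hθ : 0 < θ) (hθ' : θ < 1) (hβ : 0 < β) :
    1 < 9 * (1 + β) / (4 * θ) := by
  rw [one_lt_div (by positivity)]
  linarith

theorem potential_le_succ_left (hθ : 0 < θ) (hθ' : θ < 1) (hβ : 0 < β) :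
    potential p θ β y₀ F N ≤ potential p θ β y₀ (F + 1) N := by
  rw [potential_succ_left]
  exact le_mul_of_one_le_left (potential_nonneg hθ hβ) (one_lt_potential_base hθ hθ' hβ).le

theorem initial_invariant (hμ : 0 < μ) (hq : p.IsQG μ) (ho : p.IsSubgradientOracle)
    (hmu : μ ≤ muHat₁) (hy₀ : y₀ ∈ p.X) (hg : p.g y₀ ≠ 0) :
    RunInvariant p θ β μ ε y₀ muHat₁ M 0 0 0 (initial p y₀ muHat₁) where
  y_mem := hy₀
  gap_pos := by
    have := norm_pos_iff.2 hg
    have : 0 < muHat₁ := hμ.trans_le hmu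
    simp only [initial]
    positivity
  low_eq := rfl
  muHat_eq := by simp [initial]
  lt_muHat := by simp only [initial]; linarith
  valid := fun h => by
    have h1 : muHat₁ = μ := le_antisymm h hmu
    simp only [initial]
    rw [h1]
    exact hq.gap_le_grad hμ ho hy₀
  muHat_mul_gap_le := by
    have : 0 < muHat₁ := hμ.trans_le hmu
    simp only [initial, potential, pow_zero, mul_one]
    rw [mul_div_cancel₀ _ this.ne']
  calls_le := by simp [initial]
  not_met := Or.inl rfl
  generate := fun _ => ⟨by simp, Or.inl ⟨rfl, rfl, rfl⟩⟩
  reduce := fun h => by simp [initial] at h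

/-- The new gap estimate after a wrong guess. -/
theorem RunInvariant.transferMin_spec (hp : p.Admissible k m L) (hμ : 0 < μ) (hq : p.IsQG μ)
    (hθ : 0 < θ) (hθ' : θ < 1) (hβ : 0 < β)
    (hS : RunInvariant p θ β μ ε y₀ muHat₁ M n F N S) (hph : S.phase = .generate)
    (hg : 0 < ‖p.g S.y‖) {ν : ℝ} (hν0 : 0 < ν) (hν : ν ≤ S.muHat) :
    0 < transferMin S.prev ν (2 / ν * ‖p.g S.y‖ ^ 2) ∧
    (ν ≤ μ → p.f S.y - p.optVal ≤ transferMin S.prev ν (2 / ν * ‖p.g S.y‖ ^ 2)) ∧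
    ν * transferMin S.prev ν (2 / ν * ‖p.g S.y‖ ^ 2) ≤ potential p θ β y₀ (F + 1) N := by
  have hgrad : ν ≤ μ → p.f S.y - p.optVal ≤ 2 / ν * ‖p.g S.y‖ ^ 2 := fun h => by
    refine (hq.gap_le_grad hμ hp.oracle hS.y_mem).trans ?_
    rw [div_mul_eq_mul_div]
    gcongr
  obtain ⟨-, ⟨hprev, hy, hN⟩ | ⟨a, b, hprev, ha, hb, hνa, hgap, hab⟩⟩ := hS.generate hph
  · rw [hprev]
    refine ⟨by simp only [transferMin]; positivity, hgrad, ?_⟩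
    -- In the first stage the gradient bound times the guess does not depend on the guess.
    have h1 : ν * (2 / ν * ‖p.g S.y‖ ^ 2) = potential p θ β y₀ 0 0 := by
      rw [hy]; unfold potential; field_simp
    simp only [transferMin]
    rw [h1, hN]
    unfold potential
    have := one_le_pow₀ (n := F + 1) (one_lt_potential_base hθ hθ' hβ).le
    rw [pow_zero, pow_zero, mul_one, mul_one, mul_one]
    exact le_mul_of_one_le_right (by positivity) this
  · rw [hprev]
    simp only [transferMin]
    refine ⟨lt_min (by positivity) (by positivity), fun h => le_min ?_ (hgrad h), ?_⟩
    -- As `ν ≤ a` and `ν ≤ μ`, the factor `9 * a / (4 * ν)` dominates both `1` and `a / μ`.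
    · refine hgap.trans (mul_le_mul_of_nonneg_right (max_le ?_ ?_) hb.le)
      · rw [le_div_iff₀ (by positivity)]
        linarith [hν.trans hνa]
      · rw [div_le_div_iff₀ hμ (by positivity)]
        nlinarith
    · calc ν * min (9 * a / (4 * ν) * b) (2 / ν * ‖p.g S.y‖ ^ 2)
          ≤ ν * (9 * a / (4 * ν) * b) := by gcongr; exact min_le_left _ _
        _ = 9 / 4 * (a * b) := by field_simp
        _ ≤ 9 / 4 * ((1 + β) / θ * potential p θ β y₀ F N) := by gcongr
        _ = _ := by rw [potential_succ_left]; field_simp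

/-- A failure refutes the gap estimate, so the guess exceeds `μ` and its quarter exceeds `μ / 4`. It
also shows that the center is not optimal, whence the subgradient is nonzero and the new estimate
positive. -/
theorem RunInvariant.step_generate (hp : p.Admissible k m L)
    (hpick : ∀ t, ∀ S : Set (Vec d), S.Finite → S.Nonempty →
      pick t S ∈ S ∧ ∀ z ∈ S, p.f (pick t S) ≤ p.f z) (hμ : 0 < μ) (hq : p.IsQG μ)
    (hθ : 0 < θ) (hθ' : θ < 1) (hβ : 0 < β) {t₀ : ℕ} (ht₀ : 1 ≤ t₀)
    (hbound : ∀ ν, μ / 4 < ν → 16 * L * (1 + β) / (ν * β) + 6 * (1 + β) / β ≤ (t₀ : ℝ) ^ 2)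
    (hS : RunInvariant p θ β μ ε y₀ muHat₁ (t₀ * m) n F N S) (hph : S.phase = .generate) :
    ∃ S' F', next p m θ β pick S = some S' ∧
      RunInvariant p θ β μ ε y₀ muHat₁ (t₀ * m) (n + 1) F' N S' := by
  have hmu0 : 0 < S.muHat := lt_trans (by positivity) hS.lt_muHat
  obtain ⟨r, hr, hcalls, hsucc, hfail⟩ := awg_spec hp hpick hS.y_mem hS.gap_pos hβ hmu0 ht₀
    (hbound _ hS.lt_muHat)
  have hcl := hS.calls_le
  obtain ⟨hn, hprev⟩ := hS.generate hph
  by_cases hs : r.success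
  · refine ⟨{ S with
        phase := .reduce
        delta := (1 + β) * S.gap
        mu := S.muHat
        points := r.points
        calls := S.calls + r.calls }, F, ?_, ?_⟩
    · simp only [next, hph]
      rw [hr, Option.map_some, if_pos hs]
    · refine ⟨hS.y_mem, hS.gap_pos, hS.low_eq, hS.muHat_eq, hS.lt_muHat, hS.valid,
        hS.muHat_mul_gap_le, ?_, hS.not_met, fun h => by simp at h, fun _ => ⟨by omega, rfl, ?_,
        le_rfl, ?_⟩⟩
      · simp only
        rw [Nat.succ_mul]
        omega
      · have := hS.gap_pos
        simp only
        positivity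
      · have := hsucc hs
        simp only
        rwa [mul_assoc] at this
  · obtain ⟨x, hx, hfx⟩ := hfail hs
    have hlt : S.gap < p.f S.y - p.optVal := by linarith [hq.optVal_le hx]
    have hmu : μ < S.muHat := not_le.1 fun h => absurd (hS.valid h) (not_le.2 hlt)
    have hg : 0 < ‖p.g S.y‖ := by
      have h1 := hq.gap_le_grad hμ hp.oracle hS.y_mem
      rcases (norm_nonneg (p.g S.y)).eq_or_lt with h0 | h0
      · rw [← h0] at h1
        simp only [ne_eq, OfNat.ofNat_ne_zero, not_false_eq_true, zero_pow, mul_zero,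
          zero_div] at h1
        linarith [hS.gap_pos]
      · exact h0
    obtain ⟨hpos, hvalid, hpot⟩ := hS.transferMin_spec hp hμ hq hθ hθ' hβ hph hg
      (ν := S.muHat / 4) (by positivity) (by linarith)
    have hmono : potential p θ β y₀ F N ≤ potential p θ β y₀ (F + 1) N :=
      potential_le_succ_left hθ hθ' hβ
    refine ⟨{ S with
        muHat := S.muHat / 4
        gap := transferMin S.prev (S.muHat / 4) (2 / (S.muHat / 4) * ‖p.g S.y‖ ^ 2)
        low := p.f S.y - transferMin S.prev (S.muHat / 4) (2 / (S.muHat / 4) * ‖p.g S.y‖ ^ 2)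
        calls := S.calls + r.calls + 1 }, F + 1, ?_, ?_⟩
    · simp only [next, hph]
      rw [hr, Option.map_some, if_neg hs]
    · refine ⟨hS.y_mem, hpos, rfl, ?_, by simp only; linarith, hvalid, hpot, ?_, ?_,
        fun _ => ⟨by omega, ?_⟩, fun h => by simp [hph] at h⟩
      · simp only
        rw [hS.muHat_eq, pow_succ, div_div]
      · simp only
        rw [Nat.succ_mul]
        omega
      · refine hS.not_met.imp_right fun h => h.trans_le ?_
        gcongr
      · refine hprev.imp_right ?_
        rintro ⟨a, b, h1, h2, h3, h4, h5, h6⟩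
        refine ⟨a, b, h1, h2, h3, by simp only; linarith, h5, h6.trans ?_⟩
        gcongr

/-- Either outcome shrinks the gap estimate by at least the factor `θ`. An upper step preserves the
lower estimate; a lower step proves a new one, for guesses at most `μ`, through `BallCert.gap_le`.
-/
theorem RunInvariant.step_reduce (hp : p.Admissible k m L)
    (hpick : ∀ t, ∀ S : Set (Vec d), S.Finite → S.Nonempty →
      pick t S ∈ S ∧ ∀ z ∈ S, p.f (pick t S) ≤ p.f z) (hμ : 0 < μ) (hq : p.IsQG μ)
    (hθ : 1 / 2 < θ) (hθ' : θ < 1) (hβ : 0 < β) {t₀ : ℕ} (ht₀ : 1 ≤ t₀)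
    (hbound : ∀ ν, μ / 4 < ν →
      √(6 * θ / (2 * θ - 1) + 16 * L * θ / (ν * (2 * θ - 1))) ≤ t₀)
    (hS : RunInvariant p θ β μ ε y₀ muHat₁ (t₀ * m) n F N S) (hph : S.phase = .reduce)
    (hnot : ε ^ 2 < 2 * S.mu * S.delta) :
    ∃ S', next p m θ β pick S = some S' ∧
      RunInvariant p θ β μ ε y₀ muHat₁ (t₀ * m) (n + 1) F (N + 1) S' := by
  have hθ0 : 0 < θ := by linarith
  have hmu0 : 0 < S.muHat := lt_trans (by positivity) hS.lt_muHat
  have hgap0 := hS.gap_pos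
  obtain ⟨r, hr, hcalls, hsucc, hlower, hupper⟩ := agr_spec hp hpick hS.y_mem hgap0 hθ
    hmu0 ht₀ (hbound _ hS.lt_muHat)
  rw [← hS.low_eq] at hr hupper
  have hcl := hS.calls_le
  obtain ⟨hn, hmueq, hdelta0, hdelta, hcert⟩ := hS.reduce hph
  rw [hmueq] at hnot hcert
  have hU : S.muHat * S.delta ≤ (1 + β) * potential p θ β y₀ F N :=
    calc S.muHat * S.delta ≤ S.muHat * ((1 + β) * S.gap) := by gcongr
      _ = (1 + β) * (S.muHat * S.gap) := by ring
      _ ≤ _ := by gcongr; exact hS.muHat_mul_gap_le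
  -- The accuracy test failed before this reduction, when the potential was larger by `1 / θ`; this
  -- is the `θ` on the left.
  have hnot' : N + 1 = 0 ∨ ε ^ 2 * θ < 2 * (1 + β) * potential p θ β y₀ F (N + 1) := by
    right
    rw [potential_succ_right]
    nlinarith
  have hpot : ∀ g, g ≤ θ * S.gap → S.muHat * g ≤ potential p θ β y₀ F (N + 1) := fun g hg => by
    rw [potential_succ_right]
    calc S.muHat * g ≤ S.muHat * (θ * S.gap) := by gcongr
      _ = θ * (S.muHat * S.gap) := by ring
      _ ≤ _ := by gcongr; exact hS.muHat_mul_gap_le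
  by_cases hup : r.upper
  · obtain ⟨hb1, hb2, hb3, hb4⟩ := hupper hup
    refine ⟨{ S with
        phase := .generate
        y := r.best
        gap := p.f r.best - S.low
        prev := some (S.mu, S.delta)
        calls := S.calls + r.calls }, ?_, ?_⟩
    · simp only [next, hph]
      rw [hr, Option.map_some, if_pos hsucc, if_pos hup]
    · refine ⟨hb1, ?_, by simp, hS.muHat_eq, hS.lt_muHat, fun h => ?_, hpot _ hb4, ?_, hnot',
        fun _ => ⟨by omega, Or.inr ⟨_, _, rfl, ?_, hdelta0, hmueq.ge, ?_, ?_⟩⟩,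
        fun h => by simp at h⟩
      · simp only
        rw [hS.low_eq]
        nlinarith
      · have := hS.valid h
        simp only
        rw [hS.low_eq]
        linarith
      · simp only
        rw [Nat.succ_mul]
        omega
      · rwa [hmueq]
      · have h1 := hcert.gap_le hp.convexOn.1 hp.oracle hq hμ
          (Real.sqrt_pos.2 (by positivity)) hdelta0 hmu0 (Real.sq_sqrt (by positivity))
        rw [hmueq]
        simp only
        linarith
      -- The stored pair predates the reduction just counted, hence the factor `1 / θ` in its bound.
      · rw [hmueq, potential_succ_right]
        refine hU.trans_eq ?_
        field_simp
  · have hc := hlower hup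
    refine ⟨{ S with
        gap := θ * S.gap
        low := p.f S.y - θ * S.gap
        delta := θ * S.gap
        mu := S.muHat
        points := r.points
        calls := S.calls + r.calls }, ?_, ?_⟩
    · simp only [next, hph]
      rw [hr, Option.map_some, if_pos hsucc, if_neg hup]
    · refine ⟨hS.y_mem, by simp only; positivity, rfl, hS.muHat_eq, hS.lt_muHat, fun h => ?_,
        hpot _ le_rfl, ?_, hnot', fun h => by simp [hph] at h, fun _ => ⟨by omega, rfl,
        by simp only; positivity, ?_, ?_⟩⟩
      · have h1 := hc.gap_le hp.convexOn.1 hp.oracle hq hμ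
          (Real.sqrt_pos.2 (by positivity)) (by positivity) hmu0
          (by rw [Real.sq_sqrt (by positivity)]; ring)
        rwa [max_eq_left ((div_le_one hμ).2 h), one_mul] at h1
      · simp only
        rw [Nat.succ_mul]
        omega
      · simp only
        have : 0 < θ * S.gap := by positivity
        nlinarith
      · simp only
        rwa [mul_assoc] at hc

/-- With `r ^ 2 = 2 * δ / μ̂`, the slope is `δ / r = μ̂ * r / 2`; the test gives `μ̂ * r ≤ ε`, which
controls both radius and slope. -/
theorem RunInvariant.isWCert (hp : p.Admissible k m L) (hε : 0 < ε) (hμ : 0 < μ)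
    (hS : RunInvariant p θ β μ ε y₀ muHat₁ M n F N S) (hph : S.phase = .reduce)
    (hmet : 2 * S.mu * S.delta ≤ ε ^ 2) : p.IsWCert (ε / S.mu) ε S.y S.points := by
  obtain ⟨-, hmueq, hdelta0, -, hcert⟩ := hS.reduce hph
  have hmu0 : 0 < S.mu := by
    rw [hmueq]
    exact lt_trans (by positivity) hS.lt_muHat
  have hr0 : 0 < √(2 * S.delta / S.mu) := Real.sqrt_pos.2 (by positivity)
  have hrsq : √(2 * S.delta / S.mu) ^ 2 = 2 * S.delta / S.mu := Real.sq_sqrt (by positivity)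
  have hr : √(2 * S.delta / S.mu) ≤ ε / S.mu := by
    refine Real.sqrt_le_iff.2 ⟨by positivity, ?_⟩
    rw [div_pow, div_le_div_iff₀ hmu0 (by positivity)]
    nlinarith
  refine hcert.isWCert hp.convexOn.1 hp.oracle hr0 hdelta0.le hr ?_
  rw [div_le_iff₀ hr0]
  rw [eq_div_iff hmu0.ne'] at hrsq
  rw [le_div_iff₀ hmu0] at hr
  nlinarith

/-! ### Counting subroutine calls. -/

theorem RunInvariant.count_le (hS : RunInvariant p θ β μ ε y₀ muHat₁ M n F N S) :
    n ≤ F + 2 * N + 1 := by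
  cases hph : S.phase with
  | generate => exact (hS.generate hph).1.trans (Nat.le_succ _)
  | reduce => exact (hS.reduce hph).1

theorem RunInvariant.failures_le (hμ : 0 < μ)
    (hS : RunInvariant p θ β μ ε y₀ muHat₁ M n F N S) :
    (F : ℝ) ≤ Real.logb 4 (4 * muHat₁ / μ) := by
  have h1 := hS.lt_muHat
  rw [hS.muHat_eq, div_lt_div_iff₀ (by norm_num) (by positivity)] at h1
  have h2 : (4 : ℝ) ^ F ≤ 4 * muHat₁ / μ := by
    rw [le_div_iff₀ hμ]
    linarith
  rw [Real.le_logb_iff_rpow_le (by norm_num) (lt_of_lt_of_le (by positivity) h2),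
    Real.rpow_natCast]
  exact h2

/-- Logarithm of `not_met`: an unmet accuracy keeps the potential above a multiple of `ε ^ 2`, so
reductions are bounded in terms of failures. -/
theorem RunInvariant.reductions_le (hθ : 0 < θ) (hθ' : θ < 1) (hβ : 0 < β) (hε : 0 < ε)
    (hg : p.g y₀ ≠ 0) (hS : RunInvariant p θ β μ ε y₀ muHat₁ M n F N S) :
    N * -Real.log θ ≤ Real.log (4 * (1 + β) / θ) + F * Real.log (9 * (1 + β) / (4 * θ)) +
      max 0 (Real.log (‖p.g y₀‖ ^ 2 / ε ^ 2)) := by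
  have hK := one_lt_potential_base hθ hθ' hβ
  have hmax := le_max_left 0 (Real.log (‖p.g y₀‖ ^ 2 / ε ^ 2))
  have hmax' := le_max_right 0 (Real.log (‖p.g y₀‖ ^ 2 / ε ^ 2))
  have h1 : 0 ≤ Real.log (4 * (1 + β) / θ) :=
    Real.log_nonneg ((one_le_div hθ).2 (by linarith))
  have h2 : 0 ≤ (F : ℝ) * Real.log (9 * (1 + β) / (4 * θ)) :=
    mul_nonneg (Nat.cast_nonneg _) (Real.log_nonneg hK.le)
  rcases hS.not_met with h | h
  · rw [h, Nat.cast_zero, zero_mul]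
    linarith
  · have hgp : 0 < ‖p.g y₀‖ := norm_pos_iff.2 hg
    have hK0 : 0 < 9 * (1 + β) / (4 * θ) := by positivity
    have h3 : 1 ≤ 4 * (1 + β) / θ * (‖p.g y₀‖ ^ 2 / ε ^ 2) *
        (9 * (1 + β) / (4 * θ)) ^ F * θ ^ N := by
      unfold potential at h
      generalize 9 * (1 + β) / (4 * θ) = K at *
      have h4 : 4 * (1 + β) / θ * (‖p.g y₀‖ ^ 2 / ε ^ 2) * K ^ F * θ ^ N =
          2 * (1 + β) * (2 * ‖p.g y₀‖ ^ 2 * K ^ F * θ ^ N) / (ε ^ 2 * θ) := by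
        field_simp
        ring
      rw [h4, one_le_div (by positivity)]
      exact h.le
    have h5 := Real.log_nonneg h3
    rw [Real.log_mul (by positivity) (by positivity),
      Real.log_mul (by positivity) (by positivity),
      Real.log_mul (by positivity) (by positivity), Real.log_pow, Real.log_pow] at h5
    linarith

end

/-- Until a certificate appears the invariant propagates through every call, so all calls return;
this cannot continue past the bound `B`. -/
theorem exists_isWCert_of_bounds {d : ℕ} {p : Problem d} {k m : ℕ} {L θ β μ ε muHat₁ : ℝ}
    {y₀ : Vec d} {pick : ℕ → ℕ → Set (Vec d) → Vec d} (hp : p.Admissible k m L)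
    (hpick : IsBestPick p.f pick) (hμ : 0 < μ) (hq : p.IsQG μ)
    (hθ : 1 / 2 < θ) (hθ' : θ < 1) (hβ : 0 < β) (hε : 0 < ε) (hmu : μ ≤ muHat₁) (hy₀ : y₀ ∈ p.X)
    (hg : p.g y₀ ≠ 0) {t₀ : ℕ} (ht₀ : 1 ≤ t₀)
    (hbound₁ : ∀ ν, μ / 4 < ν → 16 * L * (1 + β) / (ν * β) + 6 * (1 + β) / β ≤ (t₀ : ℝ) ^ 2)
    (hbound₂ : ∀ ν, μ / 4 < ν →
      √(6 * θ / (2 * θ - 1) + 16 * L * θ / (ν * (2 * θ - 1))) ≤ t₀)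
    {B : ℝ} (hB : ∀ n F N S, RunInvariant p θ β μ ε y₀ muHat₁ (t₀ * m) n F N S → (n : ℝ) ≤ B) :
    ∃ n F N S, run p m θ β pick y₀ muHat₁ n = some S ∧ S.phase = .reduce ∧
      p.IsWCert (ε / S.mu) ε S.y S.points ∧
      RunInvariant p θ β μ ε y₀ muHat₁ (t₀ * m) n F N S := by
  by_contra! hcon
  have hall : ∀ n, ∃ F N S, run p m θ β pick y₀ muHat₁ n = some S ∧
      RunInvariant p θ β μ ε y₀ muHat₁ (t₀ * m) n F N S := by
    intro n
    induction n with
    | zero => exact ⟨0, 0, _, rfl, initial_invariant hμ hq hp.oracle hmu hy₀ hg⟩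
    | succ n ih =>
      obtain ⟨F, N, S, hrun, hS⟩ := ih
      have hnext : run p m θ β pick y₀ muHat₁ (n + 1) = next p m θ β (pick n) S := by
        rw [run, hrun, Option.bind_some]
      rw [hnext]
      cases hph : S.phase with
      | generate =>
        obtain ⟨S', F', h1, h2⟩ := hS.step_generate hp (hpick n) hμ hq (by linarith) hθ' hβ ht₀
          hbound₁ hph
        exact ⟨F', N, S', h1, h2⟩
      | reduce =>
        have hnot : ε ^ 2 < 2 * S.mu * S.delta := not_le.1 fun h =>
          hcon n F N S hrun hph (hS.isWCert hp hε hμ hph h) hS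
        obtain ⟨S', h1, h2⟩ := hS.step_reduce hp (hpick n) hμ hq hθ hθ' hβ ht₀ hbound₂ hph hnot
        exact ⟨F, N + 1, S', h1, h2⟩
  obtain ⟨n, hn⟩ := exists_nat_gt B
  obtain ⟨F, N, S, -, hS⟩ := hall n
  exact absurd (hB n F N S hS) (not_le.2 hn)

end RApex

/-! ### Choice of the constant and the total oracle count. -/

theorem mainTheorem2 (θ β : ℝ) (hθ : 1 / 2 < θ) (hθ' : θ < 1) (hβ : 0 < β) :
    ∃ C : ℝ, 0 < C ∧
      ∀ (d : ℕ) (p : RApex.Problem d) (k m : ℕ) (L μ muHat₁ ε : ℝ) (y₀ : RApex.Vec d)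
        (pick : ℕ → ℕ → Set (RApex.Vec d) → RApex.Vec d),
        IsClosed p.X → ConvexOn ℝ p.X p.f → p.IsSubgradientOracle →
        p.IsPWS k L → 0 < μ → p.IsQG μ → k ≤ m → μ ≤ muHat₁ → 0 < ε →
        y₀ ∈ p.X → p.g y₀ ≠ 0 → RApex.IsBestPick p.f pick →
        ∃ (n : ℕ) (S : RApex.RState d),
          RApex.run p m θ β pick y₀ muHat₁ n = some S ∧
          S.phase = RApex.Phase.reduce ∧
          p.IsWCert (ε / S.mu) ε S.y S.points ∧
          (S.calls : ℝ) ≤ C * m * max 1 √(L / μ) *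
            (Real.logb 4 (4 * muHat₁ / μ) + max 0 (Real.log (‖p.g y₀‖ ^ 2 / ε ^ 2))) := by
  have hθ0 : 0 < θ := by linarith
  have hθ1 : 0 < 2 * θ - 1 := by linarith
  -- `70 = 16 * 4 + 6`: the guess stays above `μ / 4`, so `L / ν ≤ 4 * κ ^ 2`, and `1 ≤ κ ^ 2`
  -- absorbs the constant term.
  set a₁ := 70 * (1 + β) / β with ha₁
  set a₂ := 70 * θ / (2 * θ - 1) with ha₂
  have ha₁0 : 0 < a₁ := by positivity
  have ha₂0 : 0 < a₂ := by positivity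
  set A := √a₁ + √a₂ with hA
  have hA0 : 0 < A := by positivity
  set c₁ := Real.log (4 * (1 + β) / θ) with hc₁
  set c₂ := Real.log (9 * (1 + β) / (4 * θ)) with hc₂
  have hc₁0 : 0 ≤ c₁ := Real.log_nonneg ((one_le_div hθ0).2 (by linarith))
  have hc₂0 : 0 ≤ c₂ := Real.log_nonneg (RApex.one_lt_potential_base hθ0 hθ' hβ).le
  have hlog : 0 < -Real.log θ := neg_pos.2 (Real.log_neg hθ0 hθ')
  set c₃ := (c₁ + c₂ + 1) / -Real.log θ with hc₃
  have hc₃0 : 0 ≤ c₃ := by positivity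
  refine ⟨2 + (2 + 2 * c₃) * (A + 1), by positivity, ?_⟩
  intro d p k m L μ muHat₁ ε y₀ pick hclosed hconv ho hpws hμ hq hkm hmu hε hy₀ hg hpick
  have hp : p.Admissible k m L := ⟨hclosed, hconv, ho, hpws, hkm⟩
  have hL := hpws.1
  set κ := max 1 √(L / μ) with hκ
  have hκ1 : 1 ≤ κ := le_max_left _ _
  have hκ0 : 0 < κ := by linarith
  have hκsq : L / μ ≤ κ ^ 2 := by
    rw [← Real.sqrt_le_left hκ0.le]
    exact le_max_right _ _
  have hκsq1 : 1 ≤ κ ^ 2 := one_le_pow₀ hκ1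
  have hLν : ∀ ν, μ / 4 < ν → L / ν ≤ 4 * κ ^ 2 := fun ν hν => by
    calc L / ν ≤ L / (μ / 4) := by gcongr
      _ = 4 * (L / μ) := by field_simp
      _ ≤ _ := by gcongr
  set t₀ := ⌈A * κ⌉₊ with ht₀def
  have ht₀ : A * κ ≤ t₀ := Nat.le_ceil _
  have ht₀1 : 1 ≤ t₀ := Nat.ceil_pos.2 (by positivity)
  have ht₀le : (t₀ : ℝ) ≤ (A + 1) * κ := by
    have := (Nat.ceil_lt_add_one (by positivity : 0 ≤ A * κ)).le
    linarith
  have hroot : ∀ a, 0 ≤ a → √a ≤ A → a * κ ^ 2 ≤ (t₀ : ℝ) ^ 2 := fun a ha h => by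
    rw [← Real.sq_sqrt ha, ← mul_pow]
    have : √a * κ ≤ t₀ := le_trans (by gcongr) ht₀
    gcongr
  have hb₁ : ∀ ν, μ / 4 < ν →
      16 * L * (1 + β) / (ν * β) + 6 * (1 + β) / β ≤ (t₀ : ℝ) ^ 2 := fun ν hν => by
    refine le_trans ?_ (hroot a₁ ha₁0.le (by linarith [Real.sqrt_nonneg a₂]))
    calc 16 * L * (1 + β) / (ν * β) + 6 * (1 + β) / β
        = 16 * ((1 + β) / β) * (L / ν) + 6 * ((1 + β) / β) * 1 := by
          field_simp
      _ ≤ 16 * ((1 + β) / β) * (4 * κ ^ 2) + 6 * ((1 + β) / β) * κ ^ 2 := by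
          gcongr; exact hLν ν hν
      _ = _ := by rw [ha₁]; ring
  have hb₂ : ∀ ν, μ / 4 < ν →
      √(6 * θ / (2 * θ - 1) + 16 * L * θ / (ν * (2 * θ - 1))) ≤ t₀ := fun ν hν => by
    refine Real.sqrt_le_iff.2 ⟨by positivity, ?_⟩
    refine le_trans ?_ (hroot a₂ ha₂0.le (by linarith [Real.sqrt_nonneg a₁]))
    calc 6 * θ / (2 * θ - 1) + 16 * L * θ / (ν * (2 * θ - 1))
        = 6 * (θ / (2 * θ - 1)) * 1 + 16 * (θ / (2 * θ - 1)) * (L / ν) := by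
          field_simp
      _ ≤ 6 * (θ / (2 * θ - 1)) * κ ^ 2 + 16 * (θ / (2 * θ - 1)) * (4 * κ ^ 2) := by
          gcongr; exact hLν ν hν
      _ = _ := by rw [ha₂]; ring
  set ℓ := Real.logb 4 (4 * muHat₁ / μ) with hℓ
  set w := max 0 (Real.log (‖p.g y₀‖ ^ 2 / ε ^ 2)) with hw
  have hw0 : 0 ≤ w := le_max_left _ _
  -- This lower bound absorbs all additive constants into `ℓ + w`.
  have hℓ1 : 1 ≤ ℓ := by
    have h4 : (4 : ℝ) ≤ 4 * muHat₁ / μ := by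
      rw [le_div_iff₀ hμ]
      linarith
    rw [hℓ, Real.le_logb_iff_rpow_le (by norm_num) (by linarith), Real.rpow_one]
    exact h4
  have hcount : ∀ n F N S,
      RApex.RunInvariant p θ β μ ε y₀ muHat₁ (t₀ * m) n F N S →
      (n : ℝ) ≤ (2 + 2 * c₃) * (ℓ + w) := by
    intro n F N S hS
    have h1 : (n : ℝ) ≤ F + 2 * N + 1 := by exact_mod_cast hS.count_le
    have h2 := hS.failures_le hμ
    have h3 := hS.reductions_le hθ0 hθ' hβ hε hg
    have h4 : (N : ℝ) ≤ c₃ * (ℓ + w) := by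
      rw [hc₃, div_mul_eq_mul_div, le_div_iff₀ hlog]
      have h5 : F * c₂ ≤ ℓ * c₂ := by gcongr
      nlinarith [mul_nonneg hc₁0 hw0, mul_nonneg hc₂0 hw0]
    linarith
  obtain ⟨n, F, N, S, hrun, hph, hcert, hS⟩ := RApex.exists_isWCert_of_bounds hp hpick hμ hq hθ
    hθ' hβ hε hmu hy₀ hg ht₀1 hb₁ hb₂ hcount
  refine ⟨n, S, hrun, hph, hcert, ?_⟩
  -- `y₀` lies in some piece, so `1 ≤ k ≤ m`.
  have hm : (1 : ℝ) ≤ m := by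
    obtain ⟨piece, hpiece, -⟩ := hpws.2
    rw [← hpiece] at hy₀
    obtain ⟨i, -⟩ := Set.mem_iUnion.1 hy₀
    exact_mod_cast i.pos.trans_le hkm
  -- Besides the calls inside subroutines, one call is made at `y₀` and one after each failure.
  have h1 : (S.calls : ℝ) ≤ 1 + F + n * (t₀ * m) := by exact_mod_cast hS.calls_le
  have h2 := hS.failures_le hμ
  have h3 := hcount n F N S hS
  have hmκ : 1 ≤ m * κ := one_le_mul_of_one_le_of_one_le hm hκ1
  calc (S.calls : ℝ) ≤ 1 + F + n * (t₀ * m) := h1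
    _ ≤ 2 * (ℓ + w) * 1 + (2 + 2 * c₃) * (ℓ + w) * ((A + 1) * κ * m) := by
      gcongr
      linarith
    _ ≤ 2 * (ℓ + w) * (m * κ) + (2 + 2 * c₃) * (ℓ + w) * ((A + 1) * κ * m) := by gcongr
    _ = _ := by ring
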